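/- Let $d,k$ be integers with $1\le k<d$, and let $f:\mathbb R^d\to\mathbb R$ be twice differentiable, $L$-smooth ($\|\nabla f(x)-\nabla f(y)\|\le L\|x-y\|$ for all $x,y$), $\mu$-strongly convex with $\mu>0$, and $M$-strongly self-concordant with $M\ge 0$, i.e. $\nabla^2 f(y)-\nabla^2 f(x)\preceq M\|y-x\|_z\nabla^2 f(w)$ for all $x,y,z,w\in\mathbb R^d$, where $\|v\|_z=(v^\top\nabla^2 f(z)v)^{1/2}$ and $\preceq$ is the Loewner order. Put $\varkappa=L/\mu$ and $\lambda(x)=\big(\nabla f(x)^\top(\nabla^2 f(x))^{-1}\nabla f(x)\big)^{1/2}$. The SR-$k$ method started at $(x_0,G_0)$, $G_0\in\mathbb R^{d\times d}$, computes for $t=0,1,\dots$ $$x_{t+1}=x_t-G_t^{-1}\nabla f(x_t),\qquad r_t=\|x_{t+1}-x_t\|_{x_t},\qquad \tilde G_t=(1+Mr_t)G_t,$$ $$G_{t+1}=\tilde G_t-R_tU_t(U_t^\top R_tU_t)^\dagger U_t^\top R_t,\qquad R_t=\tilde G_t-\nabla^2 f(x_{t+1}),$$ where $\dagger$ is the Moore–Penrose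 inverse and $U_t\in\mathbb R^{d\times k}$ is chosen by the randomized strategy (all entries of all the matrices $U_0,U_1,\dots$ are independent standard normal variables) or by the greedy strategy (the columns of $U_t$ are the standard basis vectors $e_{i_1},\dots,e_{i_k}$ for distinct indices $i_1,\dots,i_k$ of the $k$ largest diagonal entries of $R_t$, ties being broken arbitrarily). Suppose that, for some $\eta_0\ge 1$, $$M\lambda(x_0)\le\frac{\ln 2}{2}\cdot\frac{d-k}{\eta_0d^2\varkappa}\qquad\text{and}\qquad \nabla^2 f(x_0)\preceq G_0\preceq\eta_0\nabla^2 f(x_0).$$ Then for both strategies and every $t\ge 0$ (with the convention that the ratio is $0$ if $\lambda(x_t)=0$; for the greedy strategy the method is deterministic and the expectation is void) $$\mathbb E\left[\frac{\lambda(x_{t+1})}{\lambda(x_t)}\right]\le 2d\varkappa\eta_0\left(1-\frac kd\right)^t .$$ Moreover, there is an absolute constant $C>0$, independent of all the data above, such that the following holds. (a) For the randomized strategy and every $\delta\in(0,1)$, with $t_0=\lceil C\,d\ln(\varkappa d\eta_0/\delta)/k\rceil$, with probability at least $1-\delta$ one has for all $t\ge 0$ simultaneously $$\lambda(x_{t_0+t})\le\left(1-\frac{k}{d+k}\right)^{t(t-1)/2}\left(\frac12\right)^t\left(1-\frac1{2\eta_0}\right)^{t_0}\lambda(x_0).$$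 (b) For the greedy strategy, with $t_0=\lceil C\,d\ln(\eta_0d\varkappa)/k\rceil$, one has for all $t\ge 0$ $$\lambda(x_{t_0+t})\le\left(1-\frac kd\right)^{t(t-1)/2}\left(\frac12\right)^t\left(1-\frac1{2\eta_0}\right)^{t_0}\lambda(x_0).$$ -/

import Mathlib

namespace SRk

open Matrix MeasureTheory ProbabilityTheory

/-! ### Moore-Penrose inverse of a real matrix -/

/-- The four Penrose equations: `X` is the Moore-Penrose inverse of `S`. -/
structure IsMoorePenrose {m n : Type*} [Fintype m] [Fintype n]
    (S : Matrix m n ℝ) (X : Matrix n m ℝ) : Prop where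
  mul_mul_self : S * X * S = S
  mul_mul_inv : X * S * X = X
  symm_left : (S * X)ᵀ = S * X
  symm_right : (X * S)ᵀ = X * S

theorem IsMoorePenrose.unique {m n : Type*} [Fintype m] [Fintype n]
    {S : Matrix m n ℝ} {X Y : Matrix n m ℝ}
    (hX : IsMoorePenrose S X) (hY : IsMoorePenrose S Y) : X = Y := by
  have h1 : S * X = S * Y := by
    calc S * X = (S * X)ᵀ := hX.symm_left.symm
      _ = ((S * Y) * (S * X))ᵀ := by
          rw [← Matrix.mul_assoc, hY.mul_mul_self]
      _ = (S * X) * (S * Y) := by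
          rw [Matrix.transpose_mul, hX.symm_left, hY.symm_left]
      _ = S * Y := by rw [← Matrix.mul_assoc, hX.mul_mul_self]
  have h2 : X * S = Y * S := by
    calc X * S = (X * S)ᵀ := hX.symm_right.symm
      _ = ((X * S) * (Y * S))ᵀ := by
          rw [Matrix.mul_assoc, ← Matrix.mul_assoc S, hY.mul_mul_self]
      _ = (Y * S) * (X * S) := by
          rw [Matrix.transpose_mul, hX.symm_right, hY.symm_right]
      _ = Y * S := by rw [Matrix.mul_assoc, ← Matrix.mul_assoc S, hX.mul_mul_self]
  calc X = X * S * X := hX.mul_mul_inv.symm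
    _ = Y * (S * X) := by rw [h2, Matrix.mul_assoc]
    _ = Y * S * Y := by rw [h1, Matrix.mul_assoc]
    _ = Y := hY.mul_mul_inv

/-- A symmetric real matrix has a symmetric generalized inverse commuting with it. -/
theorem exists_symm_ginverse {n : Type*} [Fintype n] [DecidableEq n]
    (H : Matrix n n ℝ) (hH : H.IsHermitian) :
    ∃ P : Matrix n n ℝ, Pᵀ = P ∧ H * P * H = H ∧ P * H * P = P ∧ P * H = H * P := by
  set V : Matrix n n ℝ := (hH.eigenvectorUnitary : Matrix n n ℝ) with hV
  set e : n → ℝ := hH.eigenvalues with he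
  have hVV : Vᵀ * V = 1 := by
    have := Unitary.coe_star_mul_self hH.eigenvectorUnitary
    simpa [Matrix.star_eq_conjTranspose] using this
  have hHs : H = V * diagonal e * Vᵀ := by
    have h := hH.spectral_theorem
    rw [Unitary.conjStarAlgAut_apply] at h
    simpa [Matrix.star_eq_conjTranspose, Function.comp_def] using h
  have key : ∀ a b : n → ℝ, (V * diagonal a * Vᵀ) * (V * diagonal b * Vᵀ)
      = V * diagonal (fun i => a i * b i) * Vᵀ := by
    intro a b
    calc (V * diagonal a * Vᵀ) * (V * diagonal b * Vᵀ)
        = V * diagonal a * (Vᵀ * V) * diagonal b * Vᵀ := by simp only [Matrix.mul_assoc]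
      _ = _ := by rw [hVV, Matrix.mul_one, Matrix.mul_assoc V, diagonal_mul_diagonal]
  refine ⟨V * diagonal (fun i => (e i)⁻¹) * Vᵀ, ?_, ?_, ?_, ?_⟩
  · simp [Matrix.transpose_mul, Matrix.mul_assoc]
  · rw [hHs, key, key]
    congr 3; funext i
    by_cases h : e i = 0 <;> simp [h]
  · rw [hHs, key, key]
    congr 3; funext i
    by_cases h : e i = 0 <;> simp [h]
  · rw [hHs, key, key]
    congr 3; funext i
    ring

theorem exists_isMoorePenrose {m n : Type*} [Fintype m] [Fintype n]
    (S : Matrix m n ℝ) : ∃ X, IsMoorePenrose S X := by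
  classical
  obtain ⟨P, hPt, hHPH, hPHP, hcomm⟩ := exists_symm_ginverse (Sᵀ * S)
    (by simpa using Matrix.isHermitian_conjTranspose_mul_self S)
  have hS : S * P * (Sᵀ * S) = S := by
    have h0 : (S * P * (Sᵀ * S) - S)ᵀ * (S * P * (Sᵀ * S) - S) = 0 := by
      have ht : (S * P * (Sᵀ * S) - S)ᵀ = (Sᵀ * S) * P * Sᵀ - Sᵀ := by
        simp [Matrix.transpose_mul, hPt, Matrix.mul_assoc]
      rw [ht]
      have e1 : (Sᵀ * S * P * Sᵀ - Sᵀ) * (S * P * (Sᵀ * S) - S)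
          = (Sᵀ * S * P * (Sᵀ * S)) * P * (Sᵀ * S) - Sᵀ * S * P * (Sᵀ * S)
            - Sᵀ * S * P * (Sᵀ * S) + Sᵀ * S := by
        simp only [Matrix.sub_mul, Matrix.mul_sub, Matrix.mul_assoc]
        abel
      rw [e1, hHPH, hHPH]
      abel
    have h1 : (S * P * (Sᵀ * S) - S)ᴴ * (S * P * (Sᵀ * S) - S) = 0 := by
      simpa using h0
    exact sub_eq_zero.mp (Matrix.conjTranspose_mul_self_eq_zero.mp h1)
  refine ⟨P * Sᵀ, ?_, ?_, ?_, ?_⟩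
  · simpa only [Matrix.mul_assoc] using hS
  · have := congrArg (fun Z => Z * Sᵀ) hPHP
    simpa only [Matrix.mul_assoc] using this
  · simp [Matrix.transpose_mul, hPt, Matrix.mul_assoc]
  · have : P * Sᵀ * S = Sᵀ * S * P := by rw [Matrix.mul_assoc, hcomm]
    conv_rhs => rw [this]
    simp [Matrix.transpose_mul, hPt, Matrix.mul_assoc]

/-- The Moore-Penrose inverse `S†`. -/
noncomputable def pinv {m n : Type*} [Fintype m] [Fintype n]
    (S : Matrix m n ℝ) : Matrix n m ℝ :=
  Classical.choose (exists_isMoorePenrose S)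

theorem pinv_spec {m n : Type*} [Fintype m] [Fintype n] (S : Matrix m n ℝ) :
    IsMoorePenrose S (pinv S) :=
  Classical.choose_spec (exists_isMoorePenrose S)

/-! ### The objective function -/

/-- The Hessian matrix, `(i, j) ↦ ∂ⱼ (∂ᵢ f) (x)`. -/
noncomputable def hess {d : ℕ} (f : EuclideanSpace ℝ (Fin d) → ℝ)
    (x : EuclideanSpace ℝ (Fin d)) : Matrix (Fin d) (Fin d) ℝ :=
  Matrix.of fun i j => (fderiv ℝ (gradient f) x (EuclideanSpace.single j 1)) i

/-- The Loewner order `A ⪯ B`. -/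
def Loewner {d : ℕ} (A B : Matrix (Fin d) (Fin d) ℝ) : Prop := (B - A).PosSemidef

/-- The weighted norm `‖v‖_A = (vᵀ A v)^(1/2)`. -/
noncomputable def wnorm {d : ℕ} (A : Matrix (Fin d) (Fin d) ℝ)
    (v : EuclideanSpace ℝ (Fin d)) : ℝ :=
  Real.sqrt (v.ofLp ⬝ᵥ A *ᵥ v.ofLp)

/-- `f` is twice differentiable on `ℝᵈ` (no continuity of the second derivative is required). -/
def TwiceDifferentiable {d : ℕ} (f : EuclideanSpace ℝ (Fin d) → ℝ) : Prop :=
  Differentiable ℝ f ∧ Differentiable ℝ (gradient f)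

/-- `f` is `L`-smooth: its gradient is `L`-Lipschitz. -/
def LSmooth {d : ℕ} (L : ℝ) (f : EuclideanSpace ℝ (Fin d) → ℝ) : Prop :=
  ∀ x y, ‖gradient f x - gradient f y‖ ≤ L * ‖x - y‖

/-- `f` is `M`-strongly self-concordant. -/
def StronglySelfConcordant {d : ℕ} (M : ℝ) (f : EuclideanSpace ℝ (Fin d) → ℝ) : Prop :=
  ∀ x y z w, Loewner (hess f y - hess f x) ((M * wnorm (hess f z) (y - x)) • hess f w)

/-- The local gradient norm `λ(x) = (∇f(x)ᵀ (∇²f(x))⁻¹ ∇f(x))^(1/2)`. -/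
noncomputable def lam {d : ℕ} (f : EuclideanSpace ℝ (Fin d) → ℝ)
    (x : EuclideanSpace ℝ (Fin d)) : ℝ :=
  wnorm (hess f x)⁻¹ (gradient f x)

/-! ### The symmetric rank-`k` method -/

/-- The symmetric rank-`k` update
`SR-k(G, A, U) = G - (G - A) U (Uᵀ (G - A) U)† Uᵀ (G - A)`. -/
noncomputable def update {d k : ℕ} (G A : Matrix (Fin d) (Fin d) ℝ)
    (U : Matrix (Fin d) (Fin k) ℝ) : Matrix (Fin d) (Fin d) ℝ :=
  G - (G - A) * U * pinv (Uᵀ * (G - A) * U) * Uᵀ * (G - A)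

/-- The quasi-Newton step `x₊ = x - G⁻¹ ∇f(x)`. -/
noncomputable def nextPoint {d : ℕ} (f : EuclideanSpace ℝ (Fin d) → ℝ)
    (x : EuclideanSpace ℝ (Fin d)) (G : Matrix (Fin d) (Fin d) ℝ) :
    EuclideanSpace ℝ (Fin d) :=
  x - WithLp.toLp 2 (G⁻¹ *ᵥ (gradient f x).ofLp)

/-- The corrected estimator `G̃ = (1 + M r) G` with `r = ‖x₊ - x‖_x`. -/
noncomputable def corrected {d : ℕ} (f : EuclideanSpace ℝ (Fin d) → ℝ) (M : ℝ)
    (x : EuclideanSpace ℝ (Fin d)) (G : Matrix (Fin d) (Fin d) ℝ) :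
    Matrix (Fin d) (Fin d) ℝ :=
  (1 + M * wnorm (hess f x) (nextPoint f x G - x)) • G

/-- The pair `(x_t, G_t)` produced by the SR-`k` method from `(x₀, G₀)` when the directions
used in iteration `t` are the columns of `U t`. -/
noncomputable def run {d k : ℕ} (f : EuclideanSpace ℝ (Fin d) → ℝ) (M : ℝ)
    (x₀ : EuclideanSpace ℝ (Fin d)) (G₀ : Matrix (Fin d) (Fin d) ℝ)
    (U : ℕ → Matrix (Fin d) (Fin k) ℝ) :
    ℕ → EuclideanSpace ℝ (Fin d) × Matrix (Fin d) (Fin d) ℝ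
  | 0 => (x₀, G₀)
  | t + 1 =>
    let x := (run f M x₀ G₀ U t).1
    let G := (run f M x₀ G₀ U t).2
    (nextPoint f x G, update (corrected f M x G) (hess f (nextPoint f x G)) (U t))

/-- Randomized strategy: all entries of all the matrices `U 0, U 1, …` are independent standard
normal variables. -/
def IsRandomized {d k : ℕ} {Ω : Type*} [MeasurableSpace Ω] (P : Measure Ω)
    (U : Ω → ℕ → Matrix (Fin d) (Fin k) ℝ) : Prop :=
  (∀ t i j, HasLaw (fun ω => U ω t i j) (gaussianReal 0 1) P) ∧
  iIndepFun (fun (p : ℕ × Fin d × Fin k) (ω : Ω) => U ω p.1 p.2.1 p.2.2) P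

/-- `U = E_k(A)`: the columns of `U` are the standard basis vectors `e_{s 0}, …, e_{s (k-1)}`,
where `s 0, …, s (k-1)` are distinct indices of the `k` largest diagonal entries of `A`
(ties may be broken, and the columns ordered, in any way). -/
def IsTopDiag {d k : ℕ} (A : Matrix (Fin d) (Fin d) ℝ) (U : Matrix (Fin d) (Fin k) ℝ) : Prop :=
  ∃ s : Fin k → Fin d, Function.Injective s ∧
    (∀ j, ∀ i, i ∉ Set.range s → A i i ≤ A (s j) (s j)) ∧
    U = Matrix.of fun i j => if i = s j then (1 : ℝ) else 0

/-- Greedy strategy: `U_t = E_k(G̃_t - ∇²f(x_{t+1}))` in every iteration. -/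
def IsGreedy {d k : ℕ} (f : EuclideanSpace ℝ (Fin d) → ℝ) (M : ℝ)
    (x₀ : EuclideanSpace ℝ (Fin d)) (G₀ : Matrix (Fin d) (Fin d) ℝ)
    (U : ℕ → Matrix (Fin d) (Fin k) ℝ) : Prop :=
  ∀ t, IsTopDiag
    (corrected f M (run f M x₀ G₀ U t).1 (run f M x₀ G₀ U t).2
      - hess f (run f M x₀ G₀ U (t + 1)).1) (U t)

/-- `λ(x_t)` along the run of the method. -/
noncomputable def lamAt {d k : ℕ} (f : EuclideanSpace ℝ (Fin d) → ℝ) (M : ℝ)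
    (x₀ : EuclideanSpace ℝ (Fin d)) (G₀ : Matrix (Fin d) (Fin d) ℝ)
    (U : ℕ → Matrix (Fin d) (Fin k) ℝ) (t : ℕ) : ℝ :=
  lam f (run f M x₀ G₀ U t).1

end SRk

namespace SRk

open Matrix MeasureTheory ProbabilityTheory

/-! ### Quadratic forms of positive semidefinite matrices -/

/-! Write `a = M λ(x)`, `s = tr(G - ∇²f(x)) / μ`, `K = d ϰ` and `ρ = 1 - k/d`. The invariant `∇²f(x)
⪯ G` survives every step: the factor `1 + M r` restores it at the new point, and the rank-`k` update
keeps it.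

One step moves `(a, s)` as follows. By strong convexity `G ⪯ (1 + s) ∇²f(x)`, so the quasi-Newton
step gives `a' ≤ (s/(1+s) + 11a/10) a` (`Objective.lam_nextPoint_le_gap`). The residual `R` has `tr
R / μ ≤ (1+a) s + 2Ka` (`Objective.trace_residual_le`). The update removes at least `tr(P R)`, where
`P` projects onto the range of `U` (`trace_rangeProj_mul_le_trace_reduction`); this is at least
`(k/d) tr R` for the greedy choice. For Gaussian `U` it is so on average, because invariance of the
law under row sign flips and row swaps forces `E P = (k/d) I`. Hence `s'`, or its conditional mean,
is at most `ρ ((1+a) s + 2Ka)`.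

These recursions are closed by the potential `Φ = s + 2Ka + e a s` with a tuned weight `e`: the
(conditional mean of the) new value is at most `(ρ + K a) Φ` (`Rates.potential_step`). Independently
of the directions, `a_t ≤ a_0 (1 - 1/(2η₀))^t` (`Start.linear_aux`), so the sum of the `a_t` is at
most `2 η₀ a_0` and the product of the factors is at most `ρ^t exp(2 K η₀ a_0 / ρ) ≤ 2 ρ^t`; the
last bound is exactly the hypothesis on `λ(x₀)`. Since the initial potential is at most `K η₀` and
the ratio `λ(x_{t+1})/λ(x_t)` is at most `Φ`, the bound on the ratio follows with no loss of
constants.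

For the explicit rates, `t₀` steps make the ratio bound at most `ρ^t / 2`, and multiplying ratios
gives the greedy claim. In the randomized case Markov's inequality at level `(1 - k/(d+k))^t / 2`
and a union bound over `t` cost a geometric series of ratio `1 - (k/d)²`, which the choice of `t₀`
makes at most `δ`. -/

theorem transpose_eq_of_posSemidef {n : Type*} {A : Matrix n n ℝ} (hA : A.PosSemidef) : Aᵀ = A := by
  simpa using hA.isHermitian.eq

section QuadraticForms

variable {n : Type*} [Fintype n]

theorem dotProduct_mulVec_symm {A : Matrix n n ℝ} (hA : Aᵀ = A) (u v : n → ℝ) :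
    u ⬝ᵥ A *ᵥ v = v ⬝ᵥ A *ᵥ u := by
  rw [dotProduct_mulVec, ← mulVec_transpose, hA, dotProduct_comm]

theorem posSemidef_iff_real {A : Matrix n n ℝ} :
    A.PosSemidef ↔ Aᵀ = A ∧ ∀ v, 0 ≤ v ⬝ᵥ A *ᵥ v := by
  rw [posSemidef_iff_dotProduct_mulVec]
  simp [Matrix.IsHermitian]

theorem posSemidef_quad_nonneg {A : Matrix n n ℝ} (hA : A.PosSemidef) (v : n → ℝ) :
    0 ≤ v ⬝ᵥ A *ᵥ v := (posSemidef_iff_real.mp hA).2 v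

theorem quad_le_of_posSemidef_sub {A B : Matrix n n ℝ} (h : (B - A).PosSemidef) (v : n → ℝ) :
    v ⬝ᵥ A *ᵥ v ≤ v ⬝ᵥ B *ᵥ v := by
  have := posSemidef_quad_nonneg h v
  rw [sub_mulVec, dotProduct_sub] at this
  linarith

/-- Cauchy-Schwarz for the form of a positive semidefinite matrix. -/
theorem posSemidef_cauchy_schwarz {A : Matrix n n ℝ} (hA : A.PosSemidef) (u v : n → ℝ) :
    (u ⬝ᵥ A *ᵥ v) ^ 2 ≤ (u ⬝ᵥ A *ᵥ u) * (v ⬝ᵥ A *ᵥ v) := by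
  have hs := dotProduct_mulVec_symm (transpose_eq_of_posSemidef hA)
  have key : ∀ t : ℝ, 0 ≤ (v ⬝ᵥ A *ᵥ v) * (t * t) + (2 * (u ⬝ᵥ A *ᵥ v)) * t
      + u ⬝ᵥ A *ᵥ u := by
    intro t
    have := posSemidef_quad_nonneg hA (u + t • v)
    simp only [mulVec_add, mulVec_smul, dotProduct_add, add_dotProduct, smul_dotProduct,
      dotProduct_smul, smul_eq_mul, hs v u] at this
    linarith
  have := discrim_le_zero key
  unfold discrim at this
  nlinarith

theorem posSemidef_abs_le {A : Matrix n n ℝ} (hA : A.PosSemidef) (u v : n → ℝ) :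
    u ⬝ᵥ A *ᵥ v ≤ √(u ⬝ᵥ A *ᵥ u) * √(v ⬝ᵥ A *ᵥ v) := by
  rw [← Real.sqrt_mul (posSemidef_quad_nonneg hA u)]
  exact Real.le_sqrt_of_sq_le (posSemidef_cauchy_schwarz hA u v)

/-- If `-c B ⪯ E ⪯ c B` then `|uᵀ E v| ≤ c ‖u‖_B ‖v‖_B`. -/
theorem bilin_le_of_between {E B : Matrix n n ℝ} {c : ℝ} (hc : 0 ≤ c) (hB : B.PosSemidef)
    (h1 : (c • B - E).PosSemidef) (h2 : (c • B + E).PosSemidef) (u v : n → ℝ) :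
    |u ⬝ᵥ E *ᵥ v| ≤ c * (√(u ⬝ᵥ B *ᵥ u) * √(v ⬝ᵥ B *ᵥ v)) := by
  have hBs := transpose_eq_of_posSemidef hB
  have hEs : Eᵀ = E := by
    have := transpose_eq_of_posSemidef h2
    rw [transpose_add, transpose_smul, hBs] at this
    exact add_left_cancel this
  have hq : ∀ w, |w ⬝ᵥ E *ᵥ w| ≤ c * (w ⬝ᵥ B *ᵥ w) := by
    intro w
    have a1 := posSemidef_quad_nonneg h1 w
    have a2 := posSemidef_quad_nonneg h2 w
    simp only [sub_mulVec, add_mulVec, smul_mulVec, dotProduct_add, dotProduct_sub,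
      dotProduct_smul, smul_eq_mul] at a1 a2
    rw [abs_le]; constructor <;> linarith
  set p := u ⬝ᵥ B *ᵥ u with hp
  set r := v ⬝ᵥ B *ᵥ v with hr
  have hp0 : 0 ≤ p := posSemidef_quad_nonneg hB u
  have hr0 : 0 ≤ r := posSemidef_quad_nonneg hB v
  -- Polarization: the forms of `E` at `u + t v` and `u - t v` differ by `4 t uᵀEv`, while the two
  -- bounds add up to `2c (p + t² r)`. The discriminant then gives the claim.
  have key : ∀ t : ℝ, 0 ≤ (c * r) * (t * t) + (2 * (u ⬝ᵥ E *ᵥ v)) * t + c * p := by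
    intro t
    have e1 := hq (u + t • v)
    have e2 := hq (u - t • v)
    have a1 := (abs_le.mp e1).1
    have a2 := (abs_le.mp e2).2
    simp only [mulVec_add, mulVec_sub, mulVec_smul, dotProduct_add, add_dotProduct,
      smul_dotProduct, dotProduct_sub, sub_dotProduct, dotProduct_smul, smul_eq_mul,
      dotProduct_mulVec_symm hEs v u, dotProduct_mulVec_symm hBs v u, ← hp, ← hr] at a1 a2
    linarith
  have hd := discrim_le_zero key
  unfold discrim at hd
  have : (u ⬝ᵥ E *ᵥ v) ^ 2 ≤ (c * (√p * √r)) ^ 2 := by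
    rw [mul_pow, mul_pow, Real.sq_sqrt hp0, Real.sq_sqrt hr0]; nlinarith
  exact abs_le_of_sq_le_sq this (by positivity)

end QuadraticForms

/-! ### The contraction estimate in the local norm -/

section Contraction

variable {n : Type*} [Fintype n] [DecidableEq n]

theorem quad_inv_eq {H : Matrix n n ℝ} (hH : H.PosDef) (g : n → ℝ) :
    g ⬝ᵥ H⁻¹ *ᵥ g = (H⁻¹ *ᵥ g) ⬝ᵥ H *ᵥ (H⁻¹ *ᵥ g) := by
  have hu : IsUnit H.det := (Matrix.isUnit_iff_isUnit_det _).mp hH.isUnit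
  rw [mulVec_mulVec, mul_nonsing_inv _ hu, one_mulVec, dotProduct_comm]

/-- Expansion of `‖(H + D) v‖²` in the dual norm of `H`. -/
theorem quad_inv_add {H D : Matrix n n ℝ} (hH : H.PosDef) (v : n → ℝ) :
    ((H + D) *ᵥ v) ⬝ᵥ H⁻¹ *ᵥ ((H + D) *ᵥ v)
      = v ⬝ᵥ H *ᵥ v + 2 * (v ⬝ᵥ D *ᵥ v) + (D *ᵥ v) ⬝ᵥ H⁻¹ *ᵥ (D *ᵥ v) := by
  have hu : IsUnit H.det := (Matrix.isUnit_iff_isUnit_det _).mp hH.isUnit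
  have hHi := transpose_eq_of_posSemidef hH.inv.posSemidef
  have h1 : H⁻¹ *ᵥ (H *ᵥ v) = v := by rw [mulVec_mulVec, nonsing_inv_mul _ hu, one_mulVec]
  have h2 : (H *ᵥ v) ⬝ᵥ H⁻¹ *ᵥ (D *ᵥ v) = v ⬝ᵥ D *ᵥ v := by
    rw [dotProduct_mulVec_symm hHi, h1, dotProduct_comm]
  rw [add_mulVec, mulVec_add, add_dotProduct, dotProduct_add, dotProduct_add, h1, h2,
    dotProduct_comm (H *ᵥ v) v, dotProduct_comm (D *ᵥ v) v]
  ring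

/-- If `0 ⪯ D ⪯ (η - 1) H` then `‖D v‖ ≤ (1 - 1/η) ‖(H + D) v‖` in the dual norm of `H`. -/
theorem quad_inv_contraction {H D : Matrix n n ℝ} {η : ℝ} (hη : 1 ≤ η) (hH : H.PosDef)
    (hD : D.PosSemidef) (hDH : ((η - 1) • H - D).PosSemidef) (v : n → ℝ) :
    (D *ᵥ v) ⬝ᵥ H⁻¹ *ᵥ (D *ᵥ v) ≤
      (1 - 1 / η) ^ 2 * (((H + D) *ᵥ v) ⬝ᵥ H⁻¹ *ᵥ ((H + D) *ᵥ v)) := by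
  rw [quad_inv_add hH]
  set p := (D *ᵥ v) ⬝ᵥ H⁻¹ *ᵥ (D *ᵥ v) with hp
  set m := v ⬝ᵥ D *ᵥ v with hm
  set q := v ⬝ᵥ H *ᵥ v with hq
  set y := H⁻¹ *ᵥ (D *ᵥ v) with hy
  have hm0 : 0 ≤ m := posSemidef_quad_nonneg hD v
  have hp0 : 0 ≤ p := posSemidef_quad_nonneg hH.inv.posSemidef _
  have hpy : p = y ⬝ᵥ H *ᵥ y := quad_inv_eq hH _
  have hpy2 : p = y ⬝ᵥ D *ᵥ v := by rw [hp, dotProduct_comm]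
  have hqf : ∀ w, w ⬝ᵥ D *ᵥ w ≤ (η - 1) * (w ⬝ᵥ H *ᵥ w) := by
    intro w
    have := quad_le_of_posSemidef_sub hDH w
    simpa only [smul_mulVec, dotProduct_smul, smul_eq_mul] using this
  have hmq : m ≤ (η - 1) * q := hqf v
  -- Cauchy-Schwarz for `D`, applied to `y = H⁻¹ D v` and `v`, avoids square roots of `H`; dividing
  -- by `p` gives `p ≤ (η - 1) m`.
  have hpp : p * p ≤ ((η - 1) * p) * m := by
    have := posSemidef_cauchy_schwarz hD y v
    rw [← hpy2] at this
    calc p * p = p ^ 2 := by ring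
      _ ≤ _ := this
      _ ≤ _ := mul_le_mul_of_nonneg_right (hpy ▸ hqf y) hm0
  have hpm : p ≤ (η - 1) * m := by
    rcases hp0.eq_or_lt with h | h
    · rw [← h]; exact mul_nonneg (by linarith) hm0
    · exact le_of_mul_le_mul_left (by linarith : p * p ≤ p * ((η - 1) * m)) h
  have hη0 : 0 < η := by linarith
  have e : (1 - 1 / η) ^ 2 = (η - 1) ^ 2 / η ^ 2 := by field_simp
  rw [e, div_mul_eq_mul_div, le_div_iff₀ (by positivity)]
  -- Since `η² - (η-1)² = 1 + 2(η-1)`, it suffices that `p ≤ (η-1)² q` and `2(η-1) p ≤ 2(η-1)² m`.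
  nlinarith [mul_le_mul_of_nonneg_left hpm (by linarith : 0 ≤ η - 1),
    mul_le_mul_of_nonneg_left hmq (sq_nonneg (η - 1))]

end Contraction

/-! ### The symmetric rank-`k` update -/

section Update

variable {d k : ℕ}

/-- Transposition permutes the four Penrose equations of a symmetric matrix, so uniqueness applies.
-/
theorem pinv_transpose_of_symm {m : Type*} [Fintype m] {S : Matrix m m ℝ} (hS : Sᵀ = S) :
    (pinv S)ᵀ = pinv S := by
  have h := pinv_spec S
  refine IsMoorePenrose.unique (S := S) ⟨?_, ?_, ?_, ?_⟩ h
  · have := congrArg transpose h.mul_mul_self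
    simpa [transpose_mul, hS, Matrix.mul_assoc] using this
  · have := congrArg transpose h.mul_mul_inv
    simpa [transpose_mul, hS, Matrix.mul_assoc] using this
  · have := h.symm_right
    rw [transpose_mul, hS] at this
    rw [transpose_mul, transpose_transpose, hS, this]
  · have := h.symm_left
    rw [transpose_mul, hS] at this
    rw [transpose_mul, transpose_transpose, hS, this]

theorem exists_eq_transpose_mul_self {m : Type*} [Fintype m] {R : Matrix m m ℝ}
    (hR : R.PosSemidef) : ∃ C : Matrix m m ℝ, R = Cᵀ * C := by
  classical
  open scoped MatrixOrder in
  obtain ⟨C, hC⟩ := CStarAlgebra.nonneg_iff_eq_star_mul_self.mp hR.nonneg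
  exact ⟨C, by simpa [Matrix.star_eq_conjTranspose] using hC⟩

/-- The reduction `R U (Uᵀ R U)† Uᵀ R` subtracted in a symmetric rank-`k` update. -/
noncomputable def reduction (R : Matrix (Fin d) (Fin d) ℝ) (U : Matrix (Fin d) (Fin k) ℝ) :
    Matrix (Fin d) (Fin d) ℝ :=
  R * U * pinv (Uᵀ * R * U) * Uᵀ * R

theorem posSemidef_transpose_mul_self {m n : Type*} [Fintype m] [Fintype n] (A : Matrix m n ℝ) :
    (Aᵀ * A).PosSemidef := by
  simpa using posSemidef_conjTranspose_mul_self A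

/-- With `R = CᵀC`, the matrix `Q = CU (UᵀRU)† (CU)ᵀ` is an orthogonal projection, and the reduction
and what it leaves are `CᵀQC` and `Cᵀ(1-Q)C`. -/
theorem reduction_posSemidef {R : Matrix (Fin d) (Fin d) ℝ} (hR : R.PosSemidef)
    (U : Matrix (Fin d) (Fin k) ℝ) :
    (reduction R U).PosSemidef ∧ (R - reduction R U).PosSemidef := by
  obtain ⟨C, rfl⟩ := exists_eq_transpose_mul_self hR
  have hS : Uᵀ * (Cᵀ * C) * U = (C * U)ᵀ * (C * U) := by
    simp only [transpose_mul, Matrix.mul_assoc]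
  obtain ⟨X, hX⟩ : ∃ X, X = pinv ((C * U)ᵀ * (C * U)) := ⟨_, rfl⟩
  have hXt : Xᵀ = X := hX ▸ pinv_transpose_of_symm (by simp [transpose_mul])
  have hXX : X * ((C * U)ᵀ * (C * U)) * X = X := hX ▸ (pinv_spec ((C * U)ᵀ * (C * U))).mul_mul_inv
  obtain ⟨Q, hQ⟩ : ∃ Q, Q = C * U * X * (C * U)ᵀ := ⟨_, rfl⟩
  have hQt : Qᵀ = Q := by simp [hQ, transpose_mul, hXt, Matrix.mul_assoc]
  have hQQ : Q * Q = Q := by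
    calc Q * Q = C * U * (X * ((C * U)ᵀ * (C * U)) * X) * (C * U)ᵀ := by
          simp only [hQ, Matrix.mul_assoc]
      _ = Q := by rw [hXX, hQ]
  have hred : reduction (Cᵀ * C) U = Cᵀ * Q * C := by
    rw [reduction, hS, ← hX]
    simp only [hQ, transpose_mul, Matrix.mul_assoc]
  have e1 : Cᵀ * Q * C = (Q * C)ᵀ * (Q * C) := by
    calc Cᵀ * Q * C = Cᵀ * (Q * Q) * C := by rw [hQQ]
      _ = _ := by simp only [transpose_mul, hQt, Matrix.mul_assoc]
  have e2 : Cᵀ * C - Cᵀ * Q * C = ((1 - Q) * C)ᵀ * ((1 - Q) * C) := by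
    have : (1 - Q)ᵀ * (1 - Q) = 1 - Q := by
      rw [transpose_sub, transpose_one, hQt]
      simp only [sub_mul, mul_sub, one_mul, mul_one, hQQ]
      abel
    calc Cᵀ * C - Cᵀ * Q * C = Cᵀ * (1 - Q) * C := by
          simp only [Matrix.sub_mul, Matrix.mul_sub, Matrix.mul_one]
      _ = Cᵀ * ((1 - Q)ᵀ * (1 - Q)) * C := by rw [this]
      _ = _ := by simp only [transpose_mul, Matrix.mul_assoc]
  rw [hred, e2]
  exact ⟨e1 ▸ posSemidef_transpose_mul_self _, posSemidef_transpose_mul_self _⟩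

/-- The orthogonal projection onto the range of `U`, when `U` has full column rank. -/
noncomputable def rangeProj (U : Matrix (Fin d) (Fin k) ℝ) : Matrix (Fin d) (Fin d) ℝ :=
  U * (Uᵀ * U)⁻¹ * Uᵀ

theorem rangeProj_transpose (U : Matrix (Fin d) (Fin k) ℝ) : (rangeProj U)ᵀ = rangeProj U := by
  simp [rangeProj, transpose_mul, transpose_nonsing_inv, Matrix.mul_assoc]

/-- No rank assumption is needed: if `UᵀU` is singular, its `⁻¹` is zero by convention, and so is
`rangeProj U`. -/
theorem rangeProj_mul_self (U : Matrix (Fin d) (Fin k) ℝ) :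
    rangeProj U * rangeProj U = rangeProj U := by
  by_cases h : IsUnit (Uᵀ * U).det
  · calc rangeProj U * rangeProj U
        = U * ((Uᵀ * U)⁻¹ * (Uᵀ * U)) * (Uᵀ * U)⁻¹ * Uᵀ := by
          simp only [rangeProj, Matrix.mul_assoc]
      _ = rangeProj U := by rw [nonsing_inv_mul _ h, Matrix.mul_one, rangeProj]
  · simp [rangeProj, nonsing_inv_apply_not_isUnit _ h]

theorem trace_rangeProj {U : Matrix (Fin d) (Fin k) ℝ} (hU : IsUnit (Uᵀ * U).det) :
    (rangeProj U).trace = k := by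
  rw [rangeProj, trace_mul_comm, ← Matrix.mul_assoc, mul_nonsing_inv _ hU, trace_one,
    Fintype.card_fin]

theorem rangeProj_posSemidef (U : Matrix (Fin d) (Fin k) ℝ) :
    (rangeProj U).PosSemidef ∧ (1 - rangeProj U).PosSemidef := by
  have h1 := rangeProj_transpose U
  have h2 := rangeProj_mul_self U
  constructor
  · have := posSemidef_transpose_mul_self (rangeProj U)
    rwa [h1, h2] at this
  · have := posSemidef_transpose_mul_self (1 - rangeProj U)
    rwa [transpose_sub, transpose_one, h1, Matrix.sub_mul, Matrix.one_mul, Matrix.mul_sub,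
      Matrix.mul_one, h2, sub_self, sub_zero] at this

/-- Diagonal entries lie in `[0, 1]` and Cauchy-Schwarz controls the others. This boundedness is
what makes the entries integrable under the Gaussian law. -/
theorem abs_rangeProj_le (U : Matrix (Fin d) (Fin k) ℝ) (i j : Fin d) :
    |rangeProj U i j| ≤ 1 := by
  obtain ⟨h1, h2⟩ := rangeProj_posSemidef U
  have hd : ∀ i, 0 ≤ rangeProj U i i ∧ rangeProj U i i ≤ 1 := by
    intro i
    have a := h1.diag_nonneg (i := i)
    have b := h2.diag_nonneg (i := i)
    simp at b
    exact ⟨a, b⟩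
  have hcs := posSemidef_cauchy_schwarz h1 (Pi.single i 1) (Pi.single j 1)
  simp at hcs
  rw [← sq_le_one_iff_abs_le_one]
  nlinarith [hd i, hd j]

/-- The trace removed by an update dominates the trace of `R` over the range of `U`. -/
theorem trace_rangeProj_mul_le_trace_reduction {R : Matrix (Fin d) (Fin d) ℝ}
    (hR : R.PosSemidef) (U : Matrix (Fin d) (Fin k) ℝ) :
    (rangeProj U * R).trace ≤ (reduction R U).trace := by
  have hRt := transpose_eq_of_posSemidef hR
  obtain ⟨C, hC⟩ := exists_eq_transpose_mul_self hR
  obtain ⟨S, hS⟩ : ∃ S, S = Uᵀ * R * U := ⟨_, rfl⟩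
  obtain ⟨X, hX⟩ : ∃ X, X = pinv S := ⟨_, rfl⟩
  have hSt : Sᵀ = S := by simp [hS, transpose_mul, hRt, Matrix.mul_assoc]
  have hXt : Xᵀ = X := hX ▸ pinv_transpose_of_symm hSt
  have hSX : IsMoorePenrose S X := hX ▸ pinv_spec S
  have hWX : (C * U * X)ᵀ * (C * U * X) = X := by
    calc (C * U * X)ᵀ * (C * U * X) = X * (Uᵀ * (Cᵀ * C) * U) * X := by
          simp only [transpose_mul, hXt, Matrix.mul_assoc]
      _ = X := by rw [← hC, ← hS]; exact hSX.mul_mul_inv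
  obtain ⟨W, hW⟩ : ∃ W, W = C * U * X := ⟨_, rfl⟩
  -- `Y` is the part of `R U` outside the range of `U`. The gap between the two traces turns out to
  -- be `tr(X YᵀY)`, nonnegative because `X = WᵀW`.
  obtain ⟨Y, hY⟩ : ∃ Y, Y = (1 - rangeProj U) * (R * U) := ⟨_, rfl⟩
  have hPt : (1 - rangeProj U)ᵀ = 1 - rangeProj U := by
    rw [transpose_sub, transpose_one, rangeProj_transpose]
  have hPP : (1 - rangeProj U) * (1 - rangeProj U) = 1 - rangeProj U := by
    rw [Matrix.sub_mul, Matrix.one_mul, Matrix.mul_sub, Matrix.mul_one, rangeProj_mul_self,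
      sub_self, sub_zero]
  have hYY : Yᵀ * Y = Uᵀ * R * R * U - S * (Uᵀ * U)⁻¹ * S := by
    calc Yᵀ * Y = Uᵀ * R * ((1 - rangeProj U) * (1 - rangeProj U)) * (R * U) := by
          simp only [hY, transpose_mul, hPt, hRt, Matrix.mul_assoc]
      _ = _ := by
          rw [hPP, Matrix.mul_sub, Matrix.sub_mul, Matrix.mul_one]
          simp only [hS, rangeProj, Matrix.mul_assoc]
  have hpos : 0 ≤ (X * (Yᵀ * Y)).trace := by
    have : (X * (Yᵀ * Y)).trace = ((Y * Wᵀ)ᵀ * (Y * Wᵀ)).trace := by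
      calc (X * (Yᵀ * Y)).trace = (Wᵀ * (W * (Yᵀ * Y))).trace := by
            rw [← Matrix.mul_assoc Wᵀ, hW, hWX]
        _ = (W * (Yᵀ * Y) * Wᵀ).trace := trace_mul_comm _ _
        _ = _ := by simp only [transpose_mul, transpose_transpose, Matrix.mul_assoc]
    rw [this]
    exact (posSemidef_conjTranspose_mul_self (Y * Wᵀ)).trace_nonneg
  rw [hYY, Matrix.mul_sub, trace_sub] at hpos
  have e1 : (X * (Uᵀ * R * R * U)).trace = (reduction R U).trace := by
    calc (X * (Uᵀ * R * R * U)).trace = ((X * Uᵀ * R) * (R * U)).trace := by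
          simp only [Matrix.mul_assoc]
      _ = ((R * U) * (X * Uᵀ * R)).trace := trace_mul_comm _ _
      _ = _ := by simp only [reduction, ← hS, ← hX, Matrix.mul_assoc]
  -- Cyclicity brings `S X S = S` into play, so the pseudoinverse disappears even when `S` is
  -- singular.
  have e2 : (X * (S * (Uᵀ * U)⁻¹ * S)).trace = (rangeProj U * R).trace := by
    calc (X * (S * (Uᵀ * U)⁻¹ * S)).trace = ((X * S) * ((Uᵀ * U)⁻¹ * S)).trace := by
          simp only [Matrix.mul_assoc]
      _ = (((Uᵀ * U)⁻¹ * S) * (X * S)).trace := trace_mul_comm _ _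
      _ = ((Uᵀ * U)⁻¹ * (S * X * S)).trace := by simp only [Matrix.mul_assoc]
      _ = ((Uᵀ * U)⁻¹ * Uᵀ * R * U).trace := by
          rw [hSX.mul_mul_self, hS]; simp only [Matrix.mul_assoc]
      _ = (U * ((Uᵀ * U)⁻¹ * Uᵀ * R)).trace := trace_mul_comm _ _
      _ = _ := by simp only [rangeProj, Matrix.mul_assoc]
  linarith

end Update

/-! ### Hessians of smooth strongly convex functions -/

section Hessian

variable {d : ℕ} {f : EuclideanSpace ℝ (Fin d) → ℝ}

theorem hess_mulVec (x v : EuclideanSpace ℝ (Fin d)) :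
    hess f x *ᵥ v.ofLp = (fderiv ℝ (gradient f) x v).ofLp := by
  have hv : v = ∑ j, v j • EuclideanSpace.single j (1 : ℝ) := by
    ext i
    simp [Pi.single_apply]
  ext i
  conv_rhs => rw [hv]
  simp [mulVec, dotProduct, hess, mul_comm]

theorem dotProduct_hess_mulVec (x u v : EuclideanSpace ℝ (Fin d)) :
    u.ofLp ⬝ᵥ hess f x *ᵥ v.ofLp = inner ℝ u (fderiv ℝ (gradient f) x v) := by
  rw [hess_mulVec, EuclideanSpace.inner_eq_star_dotProduct, dotProduct_comm]
  simp

/-- Symmetry of the second derivative holds at every point where the everywhere defined first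
derivative is differentiable; continuity plays no role. -/
theorem hess_transpose (hf : TwiceDifferentiable f) (x : EuclideanSpace ℝ (Fin d)) :
    (hess f x)ᵀ = hess f x := by
  have h1 : ∀ y, HasFDerivAt f (fderiv ℝ f y) y := fun y => (hf.1 y).hasFDerivAt
  have hfd : fderiv ℝ f = fun y => InnerProductSpace.toDual ℝ _ (gradient f y) := by
    funext y; simp [gradient]
  let J := (InnerProductSpace.toDual ℝ
    (EuclideanSpace ℝ (Fin d))).toContinuousLinearEquiv.toContinuousLinearMap
  have h2 : HasFDerivAt (fderiv ℝ f) (J ∘L (fderiv ℝ (gradient f) x)) x := by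
    rw [hfd]
    exact J.hasFDerivAt.comp x (hf.2 x).hasFDerivAt
  have hs := second_derivative_symmetric h1 h2
  ext i j
  have := hs (EuclideanSpace.single i 1) (EuclideanSpace.single j 1)
  simp [J, EuclideanSpace.inner_single_right] at this
  simpa [hess] using this

/-- `f` satisfies the standing assumptions on the objective function. -/
structure Objective (L μ M : ℝ) (f : EuclideanSpace ℝ (Fin d) → ℝ) : Prop where
  dim_pos : 0 < d
  mu_pos : 0 < μ
  M_nonneg : 0 ≤ M
  twiceDiff : TwiceDifferentiable f
  smooth : LSmooth L f
  convex : StrongConvexOn Set.univ μ f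
  selfConc : StronglySelfConcordant M f

variable {L μ M : ℝ}

theorem hasDerivAt_line (h : Objective L μ M f) (x v : EuclideanSpace ℝ (Fin d)) (s : ℝ) :
    HasDerivAt (fun s : ℝ => f (x + s • v)) (inner ℝ v (gradient f (x + s • v))) s := by
  have h1 : HasDerivAt (fun s : ℝ => x + s • v) v s := by
    simpa using ((hasDerivAt_id s).smul_const v).const_add x
  have h2 := ((h.twiceDiff.1 (x + s • v)).hasFDerivAt).comp_hasDerivAt s h1
  have e : inner ℝ v (gradient f (x + s • v)) = fderiv ℝ f (x + s • v) v := by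
    rw [real_inner_comm, gradient, InnerProductSpace.toDual_symm_apply]
  rw [e]
  exact h2

theorem hasDerivAt_inner_gradient_line (h : Objective L μ M f)
    (x u v : EuclideanSpace ℝ (Fin d)) (s : ℝ) :
    HasDerivAt (fun s : ℝ => inner ℝ u (gradient f (x + s • v)))
      (u.ofLp ⬝ᵥ hess f (x + s • v) *ᵥ v.ofLp) s := by
  have h1 : HasDerivAt (fun s : ℝ => x + s • v) v s := by
    simpa using ((hasDerivAt_id s).smul_const v).const_add x
  have h2 := ((h.twiceDiff.2 (x + s • v)).hasFDerivAt).comp_hasDerivAt s h1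
  rw [dotProduct_hess_mulVec]
  simpa using (hasDerivAt_const s u).inner ℝ h2

/-- Along a line, `f - (μ/2)‖·‖²` is convex, so its derivative is monotone and its second derivative
is nonnegative. -/
theorem Objective.hess_lower (h : Objective L μ M f) (x v : EuclideanSpace ℝ (Fin d)) :
    μ * ‖v‖ ^ 2 ≤ v.ofLp ⬝ᵥ hess f x *ᵥ v.ofLp := by
  have hc : ConvexOn ℝ Set.univ (fun y => f y - μ / 2 * ‖y‖ ^ 2) :=
    strongConvexOn_iff_convex.mp h.convex
  set g : ℝ → ℝ := fun s => f (x + s • v) - μ / 2 * ‖x + s • v‖ ^ 2 with hg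
  have hgc : ConvexOn ℝ Set.univ g := by
    refine ⟨convex_univ, fun a _ b _ p q hp hq hpq => ?_⟩
    have := hc.2 (Set.mem_univ (x + a • v)) (Set.mem_univ (x + b • v)) hp hq hpq
    have e : p • (x + a • v) + q • (x + b • v) = x + (p • a + q • b) • v := by
      have : x = p • x + q • x := by rw [← add_smul, hpq, one_smul]
      conv_rhs => rw [this]
      simp only [smul_add, add_smul, smul_smul, smul_eq_mul]
      abel
    rw [e] at this
    exact this
  have hline : ∀ s : ℝ, HasDerivAt (fun s : ℝ => x + s • v) v s := fun s => by
    simpa using ((hasDerivAt_id s).smul_const v).const_add x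
  have hd : ∀ s, HasDerivAt g (inner ℝ v (gradient f (x + s • v)) -
      μ * inner ℝ v (x + s • v)) s := by
    intro s
    have h2 := ((hline s).norm_sq).const_mul (μ / 2)
    refine ((hasDerivAt_line h x v s).sub h2).congr_deriv ?_
    rw [real_inner_comm v (x + s • v)]; ring
  have hmono : Monotone (deriv g) := by
    have := hgc.monotoneOn_deriv (fun s _ => (hd s).differentiableAt)
    exact fun a b hab => this (Set.mem_univ _) (Set.mem_univ _) hab
  have hdg : deriv g = fun s => inner ℝ v (gradient f (x + s • v)) - μ * inner ℝ v (x + s • v) :=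
    funext fun s => (hd s).deriv
  have h2 : HasDerivAt (deriv g)
      (v.ofLp ⬝ᵥ hess f (x + (0 : ℝ) • v) *ᵥ v.ofLp - μ * inner ℝ v v) 0 := by
    rw [hdg]
    have h3 : HasDerivAt (fun s : ℝ => inner ℝ v (x + s • v)) (inner ℝ v v) 0 := by
      simpa using (hasDerivAt_const (0 : ℝ) v).inner ℝ (hline 0)
    exact (hasDerivAt_inner_gradient_line h x v v 0).sub (h3.const_mul μ)
  have h4 : 0 ≤ deriv (deriv g) 0 := hmono.deriv_nonneg
  rw [h2.deriv, zero_smul, add_zero, real_inner_self_eq_norm_sq] at h4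
  linarith

theorem Objective.hess_upper (h : Objective L μ M f) (hL : 0 ≤ L)
    (x v : EuclideanSpace ℝ (Fin d)) :
    v.ofLp ⬝ᵥ hess f x *ᵥ v.ofLp ≤ L * ‖v‖ ^ 2 := by
  have hn : ‖fderiv ℝ (gradient f) x‖ ≤ L :=
    norm_fderiv_le_of_lip' ℝ hL (Filter.Eventually.of_forall fun y => h.smooth y x)
  rw [dotProduct_hess_mulVec]
  calc inner ℝ v (fderiv ℝ (gradient f) x v) ≤ ‖v‖ * ‖fderiv ℝ (gradient f) x v‖ :=
        real_inner_le_norm _ _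
    _ ≤ ‖v‖ * (L * ‖v‖) := by
        gcongr
        exact (fderiv ℝ (gradient f) x).le_of_opNorm_le hn v
    _ = L * ‖v‖ ^ 2 := by ring

theorem Objective.L_nonneg (h : Objective L μ M f) : 0 ≤ L := by
  have := h.smooth (EuclideanSpace.single ⟨0, h.dim_pos⟩ 1) 0
  simp at this
  exact (norm_nonneg _).trans this

theorem hess_diag_eq (x : EuclideanSpace ℝ (Fin d)) (i : Fin d) :
    hess f x i i = (EuclideanSpace.single i (1 : ℝ)).ofLp ⬝ᵥ
      hess f x *ᵥ (EuclideanSpace.single i (1 : ℝ)).ofLp := by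
  simp

theorem Objective.hess_diag_le (h : Objective L μ M f) (x : EuclideanSpace ℝ (Fin d))
    (i : Fin d) : hess f x i i ≤ L := by
  rw [hess_diag_eq]
  simpa using h.hess_upper h.L_nonneg x (EuclideanSpace.single i 1)

theorem Objective.mu_le_L (h : Objective L μ M f) : μ ≤ L := by
  have h1 := h.hess_lower 0 (EuclideanSpace.single ⟨0, h.dim_pos⟩ 1)
  have h2 := h.hess_upper h.L_nonneg 0 (EuclideanSpace.single ⟨0, h.dim_pos⟩ 1)
  simpa using h1.trans h2

theorem Objective.trace_hess_le (h : Objective L μ M f) (x : EuclideanSpace ℝ (Fin d)) :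
    (hess f x).trace ≤ d * L := by
  calc (hess f x).trace ≤ ∑ _i : Fin d, L := Finset.sum_le_sum fun i _ => h.hess_diag_le x i
    _ = d * L := by simp

theorem Objective.hess_posDef (h : Objective L μ M f) (x : EuclideanSpace ℝ (Fin d)) :
    (hess f x).PosDef := by
  rw [posDef_iff_dotProduct_mulVec]
  refine ⟨by simpa [Matrix.IsHermitian] using hess_transpose h.twiceDiff x, fun v hv => ?_⟩
  have := h.hess_lower x (WithLp.toLp 2 v)
  refine lt_of_lt_of_le ?_ (by simpa using this)
  have : 0 < ‖WithLp.toLp 2 v‖ := by simpa using hv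
  have := h.mu_pos
  positivity

end Hessian

/-! ### One step of the method -/

section Step

variable {d k : ℕ} {L μ M : ℝ} {f : EuclideanSpace ℝ (Fin d) → ℝ}

theorem wnorm_neg (A : Matrix (Fin d) (Fin d) ℝ) (v : EuclideanSpace ℝ (Fin d)) :
    wnorm A (-v) = wnorm A v := by
  simp [wnorm, mulVec_neg]

theorem wnorm_nonneg (A : Matrix (Fin d) (Fin d) ℝ) (v : EuclideanSpace ℝ (Fin d)) :
    0 ≤ wnorm A v := Real.sqrt_nonneg _

theorem lam_nonneg (x : EuclideanSpace ℝ (Fin d)) : 0 ≤ lam f x := wnorm_nonneg _ _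

/-- The quasi-Newton direction `G⁻¹ ∇f(x)`. -/
noncomputable def direction (f : EuclideanSpace ℝ (Fin d) → ℝ) (x : EuclideanSpace ℝ (Fin d))
    (G : Matrix (Fin d) (Fin d) ℝ) : EuclideanSpace ℝ (Fin d) :=
  WithLp.toLp 2 (G⁻¹ *ᵥ (gradient f x).ofLp)

theorem nextPoint_eq (x : EuclideanSpace ℝ (Fin d)) (G : Matrix (Fin d) (Fin d) ℝ) :
    nextPoint f x G = x - direction f x G := rfl

/-- The length `‖x₊ - x‖_x` of a step. -/
theorem wnorm_step (x : EuclideanSpace ℝ (Fin d)) (G : Matrix (Fin d) (Fin d) ℝ) :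
    wnorm (hess f x) (nextPoint f x G - x) = wnorm (hess f x) (direction f x G) := by
  rw [nextPoint_eq, sub_sub_cancel_left, wnorm_neg]

theorem Objective.posDef_of_hess_le (h : Objective L μ M f) {x : EuclideanSpace ℝ (Fin d)}
    {G : Matrix (Fin d) (Fin d) ℝ} (hG : Loewner (hess f x) G) : G.PosDef := by
  have := (h.hess_posDef x).add_posSemidef hG
  rwa [add_sub_cancel] at this

theorem Objective.mulVec_direction (h : Objective L μ M f) {x : EuclideanSpace ℝ (Fin d)}
    {G : Matrix (Fin d) (Fin d) ℝ} (hG : Loewner (hess f x) G) :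
    G *ᵥ (direction f x G).ofLp = (gradient f x).ofLp := by
  have hu : IsUnit G.det := (Matrix.isUnit_iff_isUnit_det _).mp (h.posDef_of_hess_le hG).isUnit
  rw [direction, mulVec_mulVec, mul_nonsing_inv _ hu, one_mulVec]

theorem Objective.wnorm_direction_le (h : Objective L μ M f) {x : EuclideanSpace ℝ (Fin d)}
    {G : Matrix (Fin d) (Fin d) ℝ} (hG : Loewner (hess f x) G) :
    wnorm (hess f x) (direction f x G) ≤ lam f x := by
  refine Real.sqrt_le_sqrt ?_
  have e : G = hess f x + (G - hess f x) := by abel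
  have hpd := h.hess_posDef x
  rw [← h.mulVec_direction hG]
  conv_rhs => rw [e]
  rw [quad_inv_add hpd, ← e]
  have h1 := posSemidef_quad_nonneg hG (direction f x G).ofLp
  have h2 := posSemidef_quad_nonneg hpd.inv.posSemidef
    ((G - hess f x) *ᵥ (direction f x G).ofLp)
  linarith

theorem Objective.loewner_of_wnorm (h : Objective L μ M f) (x y w : EuclideanSpace ℝ (Fin d)) :
    Loewner (hess f y - hess f x) ((M * wnorm (hess f x) (y - x)) • hess f w) ∧
    Loewner (hess f x - hess f y) ((M * wnorm (hess f x) (y - x)) • hess f w) := by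
  refine ⟨h.selfConc x y x w, ?_⟩
  have := h.selfConc y x x w
  rwa [← neg_sub y x, wnorm_neg] at this

/-- The bilinear form is needed, not just the quadratic one, because the linearization error is
tested against a vector other than the step. -/
theorem Objective.abs_hess_sub_le (h : Objective L μ M f) (x y u v : EuclideanSpace ℝ (Fin d)) :
    |u.ofLp ⬝ᵥ (hess f y - hess f x) *ᵥ v.ofLp| ≤ M * wnorm (hess f x) (y - x) *
      (wnorm (hess f x) u * wnorm (hess f x) v) := by
  obtain ⟨h1, h2⟩ := h.loewner_of_wnorm x y x
  refine bilin_le_of_between (mul_nonneg h.M_nonneg (wnorm_nonneg _ _))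
    (h.hess_posDef x).posSemidef h1 ?_ _ _
  rwa [Loewner, ← neg_sub (hess f y), sub_neg_eq_add] at h2

theorem wnorm_smul (A : Matrix (Fin d) (Fin d) ℝ) (v : EuclideanSpace ℝ (Fin d)) {s : ℝ}
    (hs : 0 ≤ s) : wnorm A (s • v) = s * wnorm A v := by
  simp only [wnorm, WithLp.ofLp_smul, mulVec_smul, dotProduct_smul, smul_dotProduct, smul_eq_mul]
  rw [← mul_assoc, Real.sqrt_mul (by positivity), Real.sqrt_mul_self hs]

/-- Linearization error of the gradient along a step `x - v`. -/
theorem Objective.inner_gradient_sub_le (h : Objective L μ M f)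
    (x u v : EuclideanSpace ℝ (Fin d)) :
    inner ℝ u (gradient f (x - v)) ≤ inner ℝ u (gradient f x) - u.ofLp ⬝ᵥ hess f x *ᵥ v.ofLp +
      M / 2 * wnorm (hess f x) v ^ 2 * wnorm (hess f x) u := by
  set r := wnorm (hess f x) v with hr
  set p := wnorm (hess f x) u with hp
  set B := u.ofLp ⬝ᵥ hess f x *ᵥ v.ofLp with hB
  -- A scalar function with nonpositive derivative replaces integration of the Hessian along the
  -- segment, so no integrability has to be checked. The factor `1/2` in the error comes from the
  -- linear growth in `s` of the Hessian deviation.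
  have hd : ∀ s : ℝ, HasDerivAt (fun s : ℝ => inner ℝ u (gradient f (x + s • (-v))) + s * B
      - M / 2 * r ^ 2 * p * s ^ 2)
      (u.ofLp ⬝ᵥ hess f (x + s • (-v)) *ᵥ (-v).ofLp + B - M * r ^ 2 * p * s) s := by
    intro s
    have e1 := hasDerivAt_inner_gradient_line h x u (-v) s
    have e2 := (hasDerivAt_id s).mul_const B
    have e3 := ((hasDerivAt_pow 2 s).const_mul (M / 2 * r ^ 2 * p))
    refine ((e1.add e2).sub e3).congr_deriv ?_
    simp; ring
  have hle : ∀ s : ℝ, 0 ≤ s → u.ofLp ⬝ᵥ hess f (x + s • (-v)) *ᵥ (-v).ofLp + B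
      - M * r ^ 2 * p * s ≤ 0 := by
    intro s hs
    have := h.abs_hess_sub_le x (x + s • (-v)) u (-v)
    rw [add_sub_cancel_left, wnorm_smul _ _ hs, wnorm_neg, ← hr, ← hp] at this
    have := (abs_le.mp this).2
    rw [sub_mulVec, dotProduct_sub, WithLp.ofLp_neg, mulVec_neg _ (hess f x), dotProduct_neg,
      ← hB] at this
    rw [WithLp.ofLp_neg]
    linarith
  have hanti : AntitoneOn (fun s : ℝ => inner ℝ u (gradient f (x + s • (-v))) + s * B
      - M / 2 * r ^ 2 * p * s ^ 2) (Set.Icc 0 1) := by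
    refine antitoneOn_of_deriv_nonpos (convex_Icc 0 1)
      (fun s _ => (hd s).continuousAt.continuousWithinAt)
      (fun s _ => (hd s).differentiableAt.differentiableWithinAt) fun s hs => ?_
    rw [(hd s).deriv]
    exact hle s (interior_subset hs).1
  have := hanti (Set.left_mem_Icc.mpr zero_le_one) (Set.right_mem_Icc.mpr zero_le_one) zero_le_one
  simp only [one_smul, zero_smul, add_zero, ← sub_eq_add_neg] at this
  linarith

/-- One quasi-Newton step with `∇²f(x) ⪯ G ⪯ η ∇²f(x)` contracts the local gradient norm. -/
theorem Objective.lam_nextPoint_le_sqrt (h : Objective L μ M f) {x : EuclideanSpace ℝ (Fin d)}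
    {G : Matrix (Fin d) (Fin d) ℝ} {η : ℝ} (hη : 1 ≤ η) (hG : Loewner (hess f x) G)
    (hGη : Loewner G (η • hess f x)) :
    lam f (nextPoint f x G) ≤
      √(1 + M * lam f x) * (1 - 1 / η + M * lam f x / 2) * lam f x := by
  set H := hess f x with hH
  set v := direction f x G with hv
  set y := nextPoint f x G with hy
  set a := M * lam f x with ha
  have hl0 : 0 ≤ lam f x := lam_nonneg x
  have ha0 : 0 ≤ a := mul_nonneg h.M_nonneg hl0
  have hHpd := h.hess_posDef x
  have hypd := h.hess_posDef y
  have hr : wnorm H v ≤ lam f x := h.wnorm_direction_le hG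
  have hr0 : 0 ≤ wnorm H v := wnorm_nonneg _ _
  have hMr : M * wnorm H v ≤ a := mul_le_mul_of_nonneg_left hr h.M_nonneg
  have hGv : G *ᵥ v.ofLp = (gradient f x).ofLp := h.mulVec_direction hG
  have hη1 : 0 ≤ 1 - 1 / η := by
    rw [sub_nonneg, div_le_one (by linarith)]; exact hη
  -- Testing `∇f(y)` against `u = (∇²f(y))⁻¹ ∇f(y)` gives `λ(y)²`. Since `∇f(x) = G v`,
  -- linearization leaves `⟨u, (G - H) v⟩` plus the error; one factor `λ(y)` is finally cancelled.
  set u : EuclideanSpace ℝ (Fin d) := WithLp.toLp 2 ((hess f y)⁻¹ *ᵥ (gradient f y).ofLp) with hu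
  have hlam2 : lam f y ^ 2 = u.ofLp ⬝ᵥ hess f y *ᵥ u.ofLp := by
    rw [lam, wnorm, Real.sq_sqrt (posSemidef_quad_nonneg hypd.inv.posSemidef _),
      quad_inv_eq hypd]
  have hlam2' : lam f y ^ 2 = inner ℝ u (gradient f y) := by
    rw [lam, wnorm, Real.sq_sqrt (posSemidef_quad_nonneg hypd.inv.posSemidef _),
      EuclideanSpace.inner_eq_star_dotProduct]
    simp [hu]
  -- Changing the local norm from `x` to `y` is the only source of the square root.
  have hun : wnorm H u ≤ √(1 + a) * lam f y := by
    have h1 : u.ofLp ⬝ᵥ H *ᵥ u.ofLp ≤ (1 + a) * lam f y ^ 2 := by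
      have := quad_le_of_posSemidef_sub (h.loewner_of_wnorm x y y).2 u.ofLp
      rw [sub_mulVec, dotProduct_sub, smul_mulVec, dotProduct_smul, smul_eq_mul, ← hlam2,
        hy, wnorm_step] at this
      have h3 := mul_le_mul_of_nonneg_right hMr (sq_nonneg (lam f y))
      rw [← hH, ← hv, ← hy] at this
      linarith
    calc wnorm H u ≤ √((1 + a) * lam f y ^ 2) := Real.sqrt_le_sqrt h1
      _ = _ := by rw [Real.sqrt_mul (by positivity), Real.sqrt_sq (lam_nonneg y)]
  have hD : u.ofLp ⬝ᵥ (G - H) *ᵥ v.ofLp ≤ wnorm H u * ((1 - 1 / η) * lam f x) := by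
    have hdet : IsUnit H.det := (Matrix.isUnit_iff_isUnit_det _).mp hHpd.isUnit
    have e1 : (G - H) *ᵥ v.ofLp = H *ᵥ (H⁻¹ *ᵥ ((G - H) *ᵥ v.ofLp)) := by
      rw [mulVec_mulVec, mul_nonsing_inv _ hdet, one_mulVec]
    rw [e1]
    refine (posSemidef_abs_le hHpd.posSemidef _ _).trans ?_
    refine mul_le_mul_of_nonneg_left ?_ (Real.sqrt_nonneg _)
    rw [← quad_inv_eq hHpd]
    have hc := quad_inv_contraction (η := η) hη hHpd hG (by
      rw [Loewner] at hGη
      rwa [sub_smul, one_smul, sub_sub_sub_cancel_right]) v.ofLp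
    rw [add_sub_cancel, hGv] at hc
    calc _ ≤ √((1 - 1 / η) ^ 2 * ((gradient f x).ofLp ⬝ᵥ H⁻¹ *ᵥ (gradient f x).ofLp)) :=
          Real.sqrt_le_sqrt hc
      _ = _ := by rw [Real.sqrt_mul (sq_nonneg _), Real.sqrt_sq hη1]; rfl
  have hmain : lam f y ^ 2 ≤ wnorm H u * ((1 - 1 / η) * lam f x + a / 2 * lam f x) := by
    have := h.inner_gradient_sub_le x u v
    rw [← nextPoint_eq, ← hy, ← hlam2'] at this
    have e2 : inner ℝ u (gradient f x) = u.ofLp ⬝ᵥ G *ᵥ v.ofLp := by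
      rw [hGv, EuclideanSpace.inner_eq_star_dotProduct, dotProduct_comm]; simp
    rw [e2] at this
    rw [sub_mulVec, dotProduct_sub] at hD
    have h3 : M / 2 * wnorm H v ^ 2 ≤ a / 2 * lam f x := by
      have := mul_le_mul hMr hr hr0 ha0
      nlinarith
    have h4 := mul_le_mul_of_nonneg_right h3 (wnorm_nonneg H u)
    linarith
  set c := (1 - 1 / η + a / 2) with hc
  have hc0 : 0 ≤ c := by positivity
  have h5 : lam f y * lam f y ≤ lam f y * (√(1 + a) * c * lam f x) := by
    have h6 := mul_le_mul_of_nonneg_right hun (mul_nonneg hc0 hl0)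
    have h7 : (1 - 1 / η) * lam f x + a / 2 * lam f x = c * lam f x := by rw [hc]; ring
    rw [h7] at hmain
    linarith [sq (lam f y)]
  rcases (lam_nonneg (f := f) y).eq_or_lt with h0 | h0
  · rw [← h0]; positivity
  · exact le_of_mul_le_mul_left h5 h0

/-- As `√(1+a) ≤ 1 + a/2` and `1 - 1/η ≤ 1`, the excess over `1 - 1/η` is at most `a + a²/4`, which
is at most `11a/10` for `a ≤ 2/5`. -/
theorem Objective.lam_nextPoint_le (h : Objective L μ M f) {x : EuclideanSpace ℝ (Fin d)}
    {G : Matrix (Fin d) (Fin d) ℝ} {η : ℝ} (hη : 1 ≤ η) (hG : Loewner (hess f x) G)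
    (hGη : Loewner G (η • hess f x)) (ha : M * lam f x ≤ 2 / 5) :
    lam f (nextPoint f x G) ≤ (1 - 1 / η + 11 / 10 * (M * lam f x)) * lam f x := by
  refine (h.lam_nextPoint_le_sqrt hη hG hGη).trans
    (mul_le_mul_of_nonneg_right ?_ (lam_nonneg x))
  set a := M * lam f x
  have ha0 : 0 ≤ a := mul_nonneg h.M_nonneg (lam_nonneg x)
  have hs : √(1 + a) ≤ 1 + a / 2 := by
    rw [Real.sqrt_le_left (by positivity)]; nlinarith
  have hη1 : 0 ≤ 1 - 1 / η := by
    rw [sub_nonneg, div_le_one (by linarith)]; exact hη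
  have hη2 : 1 - 1 / η ≤ 1 := by
    have : 0 ≤ 1 / η := by positivity
    linarith
  have := mul_le_mul_of_nonneg_right hs (by positivity : 0 ≤ 1 - 1 / η + a / 2)
  nlinarith

/-- The residual `G̃ - ∇²f(x₊)` of the corrected estimator. -/
noncomputable def residual (f : EuclideanSpace ℝ (Fin d) → ℝ) (M : ℝ)
    (x : EuclideanSpace ℝ (Fin d)) (G : Matrix (Fin d) (Fin d) ℝ) : Matrix (Fin d) (Fin d) ℝ :=
  corrected f M x G - hess f (nextPoint f x G)

theorem corrected_eq (x : EuclideanSpace ℝ (Fin d)) (G : Matrix (Fin d) (Fin d) ℝ) :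
    corrected f M x G = (1 + M * wnorm (hess f x) (direction f x G)) • G := by
  rw [corrected, wnorm_step]

/-- With `H = ∇²f(x)` and `H₊ = ∇²f(x₊)`, the residual splits as `(1 + Mr)(G - H)` plus `(1 + Mr) H
- H₊`; the correction factor is there to make the second summand nonnegative. -/
theorem Objective.residual_posSemidef (h : Objective L μ M f) {x : EuclideanSpace ℝ (Fin d)}
    {G : Matrix (Fin d) (Fin d) ℝ} (hG : Loewner (hess f x) G) :
    (residual f M x G).PosSemidef := by
  have h1 := (h.loewner_of_wnorm x (nextPoint f x G) x).1
  rw [wnorm_step] at h1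
  have hp : 0 ≤ 1 + M * wnorm (hess f x) (direction f x G) :=
    add_nonneg zero_le_one (mul_nonneg h.M_nonneg (wnorm_nonneg _ _))
  have h2 := PosSemidef.smul hG hp
  rw [residual, corrected_eq]
  convert h2.add h1 using 1
  module

/-- The gap of size `M r` opens twice, once from inflating `G` and once from the drift of the
Hessian, hence the `2`; each costs at most `tr ∇²f(x) ≤ d L`. -/
theorem Objective.trace_residual_le (h : Objective L μ M f) {x : EuclideanSpace ℝ (Fin d)}
    {G : Matrix (Fin d) (Fin d) ℝ} (hG : Loewner (hess f x) G) :
    (residual f M x G).trace ≤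
      (1 + M * lam f x) * (G - hess f x).trace + 2 * (d * L) * (M * lam f x) := by
  have h1 := (h.loewner_of_wnorm x (nextPoint f x G) x).2.trace_nonneg
  have hr := h.wnorm_direction_le hG
  rw [wnorm_step] at h1
  rw [residual, corrected_eq]
  set r := wnorm (hess f x) (direction f x G)
  have hMr : M * r ≤ M * lam f x := mul_le_mul_of_nonneg_left hr h.M_nonneg
  have h0 : 0 ≤ M * lam f x := mul_nonneg h.M_nonneg (lam_nonneg x)
  have hT := h.trace_hess_le x
  have hT0 := (h.hess_posDef x).posSemidef.trace_nonneg
  have hG0 : 0 ≤ (G - hess f x).trace := PosSemidef.trace_nonneg hG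
  simp only [trace_sub, trace_smul, smul_eq_mul] at h1 hG0 ⊢
  have e1 := mul_le_mul_of_nonneg_right hMr hG0
  have e2 := mul_le_mul_of_nonneg_right hMr hT0
  have e3 := mul_le_mul_of_nonneg_left hT h0
  nlinarith

/-- The pair `(x₊, G₊)` following `(x, G)` when the directions are the columns of `U`. -/
noncomputable def step (f : EuclideanSpace ℝ (Fin d) → ℝ) (M : ℝ)
    (z : EuclideanSpace ℝ (Fin d) × Matrix (Fin d) (Fin d) ℝ) (U : Matrix (Fin d) (Fin k) ℝ) :
    EuclideanSpace ℝ (Fin d) × Matrix (Fin d) (Fin d) ℝ :=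
  (nextPoint f z.1 z.2, update (corrected f M z.1 z.2) (hess f (nextPoint f z.1 z.2)) U)

theorem run_succ (x₀ : EuclideanSpace ℝ (Fin d)) (G₀ : Matrix (Fin d) (Fin d) ℝ)
    (U : ℕ → Matrix (Fin d) (Fin k) ℝ) (t : ℕ) :
    run f M x₀ G₀ U (t + 1) = step f M (run f M x₀ G₀ U t) (U t) := rfl

theorem step_snd_sub (z : EuclideanSpace ℝ (Fin d) × Matrix (Fin d) (Fin d) ℝ)
    (U : Matrix (Fin d) (Fin k) ℝ) :
    (step f M z U).2 - hess f (step f M z U).1 =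
      residual f M z.1 z.2 - reduction (residual f M z.1 z.2) U := by
  simp only [step, update, residual, reduction]
  abel

theorem Objective.step_lower (h : Objective L μ M f)
    {z : EuclideanSpace ℝ (Fin d) × Matrix (Fin d) (Fin d) ℝ} (hG : Loewner (hess f z.1) z.2)
    (U : Matrix (Fin d) (Fin k) ℝ) : Loewner (hess f (step f M z U).1) (step f M z U).2 := by
  rw [Loewner, step_snd_sub]
  exact (reduction_posSemidef (h.residual_posSemidef hG) U).2

/-- The update only decreases `G̃`. One factor `1 + M r` comes from the correction, the other from
comparing the Hessian at `x` with that at the new point. -/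
theorem Objective.step_upper (h : Objective L μ M f)
    {z : EuclideanSpace ℝ (Fin d) × Matrix (Fin d) (Fin d) ℝ} {η : ℝ} (hη : 0 ≤ η)
    (hG : Loewner (hess f z.1) z.2) (hGη : Loewner z.2 (η • hess f z.1))
    (U : Matrix (Fin d) (Fin k) ℝ) :
    Loewner (step f M z U).2 (((1 + M * lam f z.1) ^ 2 * η) • hess f (step f M z U).1) := by
  obtain ⟨x, G⟩ := z
  set r := wnorm (hess f x) (direction f x G) with hrdef
  have hr : r ≤ lam f x := h.wnorm_direction_le hG
  have hMr : M * r ≤ M * lam f x := mul_le_mul_of_nonneg_left hr h.M_nonneg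
  have hMr0 : 0 ≤ M * r := mul_nonneg h.M_nonneg (wnorm_nonneg _ _)
  have h1 := (reduction_posSemidef (h.residual_posSemidef hG) U).1
  have h2 := PosSemidef.smul hGη (by linarith : 0 ≤ 1 + M * r)
  have h3 := (h.loewner_of_wnorm x (nextPoint f x G) (nextPoint f x G)).2
  rw [wnorm_step, ← hrdef] at h3
  have h4 := PosSemidef.smul h3 (mul_nonneg (by linarith : 0 ≤ 1 + M * r) hη)
  have h5 : 0 ≤ (1 + M * lam f x) ^ 2 * η - (1 + M * r) ^ 2 * η := by
    rw [← sub_mul]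
    exact mul_nonneg (by nlinarith) hη
  have h6 := PosSemidef.smul (h.hess_posDef (nextPoint f x G)).posSemidef h5
  have e : (step f M (x, G) U).2 = (1 + M * r) • G - reduction (residual f M x G) U := by
    simp only [step, update, residual, reduction, corrected_eq, ← hrdef]
  have e1 : (step f M (x, G) U).1 = nextPoint f x G := rfl
  rw [Loewner, e, e1]
  convert ((h1.add h2).add h4).add h6 using 1
  simp only
  module

end Step

/-! ### Scalar estimates -/

section Scalar

/-- The constants of the analysis: `K = d ϰ`, `ρ = 1 - k/d`, and a bound `a₀` on `M λ(x₀)`. -/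
structure Rates (K ρ η₀ a₀ : ℝ) : Prop where
  two_le : 2 ≤ K
  rho_pos : 0 < ρ
  rho_le_one : ρ ≤ 1
  four_rho_le : 4 * ρ ≤ K
  one_le_mul : 1 ≤ (1 - ρ) * K
  one_le_eta : 1 ≤ η₀
  nonneg : 0 ≤ a₀
  small : 2 * K * a₀ * η₀ ≤ Real.log 2 * ρ

/-- The weight `e` of the product term in the potential. -/
noncomputable def weight (K ρ η₀ : ℝ) : ℝ := 2 * K / (ρ * (1 - Real.log 2 * ρ / η₀))

namespace Rates

variable {K ρ η₀ a₀ : ℝ} (r : Rates K ρ η₀ a₀)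
include r

theorem h_le : Real.log 2 * ρ / η₀ ≤ Real.log 2 * ρ := by
  have := r.rho_pos; have := Real.log_two_gt_d9
  exact div_le_self (by positivity) r.one_le_eta

theorem h_lt_one : Real.log 2 * ρ / η₀ < 1 := by
  have := r.h_le
  have := Real.log_two_lt_d9
  nlinarith [r.rho_le_one, r.rho_pos]

theorem two_K_le : 2 * K * a₀ ≤ Real.log 2 * ρ / η₀ := by
  rw [le_div_iff₀ (by linarith [r.one_le_eta])]
  exact r.small

theorem weight_pos : 0 < weight K ρ η₀ := by
  have := r.h_lt_one; have := r.rho_pos; have := r.two_le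
  have : 0 < 1 - Real.log 2 * ρ / η₀ := by linarith
  unfold weight
  positivity

theorem rho_mul_weight : ρ * weight K ρ η₀ * (1 - Real.log 2 * ρ / η₀) = 2 * K := by
  have := r.h_lt_one; have h1 := r.rho_pos.ne'
  have : 1 - Real.log 2 * ρ / η₀ ≠ 0 := by linarith
  rw [weight, mul_div_assoc', div_mul_eq_mul_div, div_eq_iff (mul_ne_zero h1 this)]
  ring

/-- This lower bound on the weight lets the product term of the potential pay for the `2K a s/(1+s)`
contributed by the new value of `a`. The weight gives equality when `2 K a` is replaced by its bound
`log 2 * ρ / η₀`. -/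
theorem two_K_le_weight {a : ℝ} (ha : a ≤ a₀) :
    2 * K ≤ ρ * weight K ρ η₀ * (1 - 2 * K * a) := by
  rw [← r.rho_mul_weight]
  have := mul_pos r.rho_pos r.weight_pos
  have h2 := r.two_K_le
  have : 2 * K * a ≤ 2 * K * a₀ := mul_le_mul_of_nonneg_left ha (by linarith [r.two_le])
  apply mul_le_mul_of_nonneg_left _ (by positivity)
  rw [r.rho_mul_weight]
  linarith

/-- The weight must not be too large either: this is what absorbs the terms of order `K a²` in
`Rates.potential_step`. -/
theorem weight_mul_le {a : ℝ} (ha : a ≤ a₀) :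
    11 / 10 * (1 + ρ * weight K ρ η₀ * a) ≤ K := by
  set h := Real.log 2 * ρ / η₀ with hh
  have hpos : 0 < 1 - h := by linarith [r.h_lt_one]
  have hwp := mul_pos r.rho_pos r.weight_pos
  have e := r.rho_mul_weight
  have h1 : (1 + ρ * weight K ρ η₀ * a) * (1 - h) ≤ 1 := by
    have h2 := r.two_K_le
    have h3 : 2 * K * a ≤ 2 * K * a₀ := mul_le_mul_of_nonneg_left ha (by linarith [r.two_le])
    have : ρ * weight K ρ η₀ * a * (1 - h) = 2 * K * a := by rw [← e]; ring
    linarith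
  have h4 : 11 / 10 ≤ K * (1 - h) := by
    have a1 := r.h_le
    have a2 := Real.log_two_lt_d9
    have a3 := Real.log_two_gt_d9
    have a4 : K * h ≤ K * (Real.log 2 * ρ) := mul_le_mul_of_nonneg_left a1 (by linarith [r.two_le])
    have a5 := mul_le_mul_of_nonneg_left r.one_le_mul (by linarith : 0 ≤ Real.log 2)
    nlinarith [r.two_le]
  exact le_of_mul_le_mul_right (by linarith) hpos

theorem a₀_le : a₀ * η₀ ≤ Real.log 2 / 8 := by
  have h1 := r.small
  have h2 := r.four_rho_le
  have hK := r.two_le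
  have hl := Real.log_two_gt_d9
  have h3 : K * (2 * (a₀ * η₀)) ≤ K * (Real.log 2 / 4) := by nlinarith
  have := le_of_mul_le_mul_left h3 (by linarith)
  linarith

theorem a₀_le_one_fifth : a₀ ≤ 1 / 10 := by
  have h1 := r.a₀_le
  have := Real.log_two_lt_d9
  nlinarith [r.one_le_eta, r.nonneg]

end Rates

/-- The potential `s + 2 K a + e a s`. -/
noncomputable def potential (K e a s : ℝ) : ℝ := s + 2 * K * a + e * a * s

/-- The delicate term is `2K a σ` with `σ = s/(1+s)`: `K a Φ` supplies only `K a s`, which cannot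
cover it. The product term `e a s` gains a second factor of order `σ + a` in a step, so its old
value, discounted by `ρ`, has room left to pay. The bounds `b3` to `b6` are the resulting balances,
grouped by monomial. -/
theorem Rates.potential_step {K ρ η₀ a₀ : ℝ} (r : Rates K ρ η₀ a₀) {a s a' s' : ℝ}
    (ha : 0 ≤ a) (haa : a ≤ a₀) (hs : 0 ≤ s) (ha' : 0 ≤ a')
    (ha'_le : a' ≤ (s / (1 + s) + 11 / 10 * a) * a)
    (hs'_le : s' ≤ ρ * ((1 + a) * s + 2 * K * a)) :
    potential K (weight K ρ η₀) a' s' ≤ (ρ + K * a) * potential K (weight K ρ η₀) a s := by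
  have h1 := r.two_K_le_weight haa
  have h2 := r.weight_mul_le haa
  have h3 := r.weight_pos
  have h4 := r.four_rho_le
  have h5 := r.rho_pos
  have h6 := r.a₀_le_one_fifth
  have hK := r.two_le
  set e := weight K ρ η₀
  obtain ⟨σ, hσ⟩ : ∃ σ, σ = s / (1 + s) := ⟨_, rfl⟩
  have hσ0 : 0 ≤ σ := by rw [hσ]; positivity
  have hσs : σ * (1 + s) = s := by rw [hσ]; field_simp
  have hσ1 : σ ≤ 1 := by nlinarith
  rw [← hσ] at ha'_le
  unfold potential
  set X := (1 + a) * s + 2 * K * a with hX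
  have hX0 : 0 ≤ X := by positivity
  have b1 : s' * (1 + e * a') ≤ ρ * X * (1 + e * a') :=
    mul_le_mul_of_nonneg_right hs'_le (by positivity)
  have b2 : (ρ * e * X + 2 * K) * a' ≤ (ρ * e * X + 2 * K) * ((σ + 11 / 10 * a) * a) :=
    mul_le_mul_of_nonneg_left ha'_le (by positivity)
  have b3 : 0 ≤ a * (σ * (ρ * e * (1 - 2 * K * a) - 2 * K)) :=
    mul_nonneg ha (mul_nonneg hσ0 (by linarith))
  have b4 : 0 ≤ a * (a * (2 * K) * (K - 11 / 10 * (1 + ρ * e * a))) :=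
    mul_nonneg ha (mul_nonneg (by positivity) (by linarith))
  have b5 : 0 ≤ a * s * (K - ρ) := mul_nonneg (by positivity) (by linarith)
  have b6 : 0 ≤ (e * a * a * s) * (K - ρ * (σ + 11 / 10 * (1 + a))) := by
    refine mul_nonneg (by positivity) ?_
    have : ρ * (σ + 11 / 10 * (1 + a)) ≤ ρ * 4 := mul_le_mul_of_nonneg_left (by linarith) h5.le
    linarith
  -- Writing `s = σ + σ s` splits the old product term: `σ s` matches the new product term, and `σ`
  -- feeds `b3`.
  have b7 : a * ρ * e * s = a * ρ * e * (σ * (1 + s)) := by rw [hσs]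
  rw [hX] at b1 b2
  linarith

/-- The product term costs at most `K log 2` and `2Ka` at most `(1 - log 2) K`; together they fill
the missing `K` in `(η₀ - 1) K`. -/
theorem Rates.potential_zero {K ρ η₀ a₀ : ℝ} (r : Rates K ρ η₀ a₀) {a s : ℝ}
    (ha : 0 ≤ a) (haa : a ≤ a₀) (hs' : s ≤ (η₀ - 1) * K) :
    potential K (weight K ρ η₀) a s ≤ K * η₀ := by
  have e1 := r.rho_mul_weight
  have hw := r.weight_pos
  have hK := r.two_le
  have hη := r.one_le_eta
  have hρ := r.rho_pos
  have l1 := Real.log_two_lt_d9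
  have l2 := Real.log_two_gt_d9
  have h3 := r.two_K_le
  have h4 := r.h_le
  have h5 := r.four_rho_le
  have h1 : 0 < 1 - Real.log 2 * ρ / η₀ := by linarith [r.h_lt_one]
  have hm := r.small
  have hρ1 := r.rho_le_one
  set e := weight K ρ η₀
  have hea : e * a * (η₀ - 1) ≤ Real.log 2 := by
    have e2 : ρ * e * (η₀ - Real.log 2 * ρ) = 2 * K * η₀ := by
      rw [← e1]; field_simp
    have e3 : e * a * (η₀ - 1) * (ρ * (η₀ - Real.log 2 * ρ)) ≤
        Real.log 2 * (ρ * (η₀ - Real.log 2 * ρ)) := by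
      have : e * a * (η₀ - 1) * (ρ * (η₀ - Real.log 2 * ρ)) = (2 * K * a * η₀) * (η₀ - 1) := by
        linear_combination (a * (η₀ - 1)) * e2
      rw [this]
      have c1 : 2 * K * a * η₀ ≤ Real.log 2 * ρ := by
        refine le_trans ?_ hm
        have : 0 ≤ 2 * K * η₀ := by positivity
        nlinarith
      have c2 := mul_le_mul_of_nonneg_right c1 (by linarith : 0 ≤ η₀ - 1)
      have c3 : Real.log 2 * ρ * (η₀ - 1) ≤ Real.log 2 * ρ * (η₀ - Real.log 2 * ρ) :=
        mul_le_mul_of_nonneg_left (by nlinarith) (by positivity)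
      linarith
    exact le_of_mul_le_mul_right e3 (mul_pos hρ (by nlinarith))
  unfold potential
  have c1 : s * (1 + e * a) ≤ (η₀ - 1) * K * (1 + e * a) :=
    mul_le_mul_of_nonneg_right hs' (by positivity)
  have c2 : e * a * (η₀ - 1) * K ≤ Real.log 2 * K := mul_le_mul_of_nonneg_right hea (by linarith)
  have c3 : 2 * K * a ≤ 2 * K * a₀ := mul_le_mul_of_nonneg_left haa (by linarith)
  have c4 : Real.log 2 * ρ ≤ (1 - Real.log 2) * K := by nlinarith
  linarith

/-- Partial sums of the geometric series of ratio `1 - 1 / (2 η₀)`. -/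
noncomputable def geoSum (η₀ : ℝ) (t : ℕ) : ℝ := ∑ j ∈ Finset.range t, (1 - 1 / (2 * η₀)) ^ j

theorem beta_bounds {η₀ : ℝ} (hη : 1 ≤ η₀) :
    0 ≤ 1 - 1 / (2 * η₀) ∧ 1 - 1 / (2 * η₀) < 1 := by
  constructor
  · rw [sub_nonneg, div_le_one (by linarith)]; linarith
  · have : 0 < 1 / (2 * η₀) := by positivity
    linarith

theorem geoSum_le {η₀ : ℝ} (hη : 1 ≤ η₀) (t : ℕ) : geoSum η₀ t ≤ 2 * η₀ := by
  obtain ⟨h0, h1⟩ := beta_bounds hη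
  have h2 := Summable.sum_le_tsum (f := fun j => (1 - 1 / (2 * η₀)) ^ j) (Finset.range t)
    (fun j _ => pow_nonneg h0 j) (summable_geometric_of_lt_one h0 h1)
  rw [tsum_geometric_of_lt_one h0 h1] at h2
  refine h2.trans (le_of_eq ?_)
  rw [sub_sub_cancel, one_div, inv_inv]

theorem geoSum_succ (η₀ : ℝ) (t : ℕ) :
    geoSum η₀ (t + 1) = geoSum η₀ t + (1 - 1 / (2 * η₀)) ^ t := Finset.sum_range_succ _ _

/-- The exponent is at most `4 a₀ η₀ ≤ (log 2)/2`, so the bound is `√2 ≤ 3/2`. It limits how much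
the ratio between `G` and the Hessian can deteriorate over all iterations. -/
theorem Rates.exp_eta_le {K ρ η₀ a₀ : ℝ} (r : Rates K ρ η₀ a₀) (t : ℕ) :
    Real.exp (2 * a₀ * geoSum η₀ t) ≤ 3 / 2 := by
  have h1 : 2 * a₀ * geoSum η₀ t ≤ Real.log 2 / 2 := by
    have := mul_le_mul_of_nonneg_left (geoSum_le r.one_le_eta t)
      (by linarith [r.nonneg] : 0 ≤ 2 * a₀)
    linarith [r.a₀_le]
  refine (Real.exp_le_exp.mpr h1).trans ?_
  rw [Real.exp_half, Real.exp_log two_pos, Real.sqrt_le_left (by norm_num)]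
  norm_num

/-- With the geometric sum at most `2 η₀`, the smallness hypothesis bounds the exponent by `log 2`;
this is the `2` of the final ratio bound. -/
theorem Rates.exp_growth_le {K ρ η₀ a₀ : ℝ} (r : Rates K ρ η₀ a₀) (t : ℕ) :
    Real.exp (K / ρ * a₀ * geoSum η₀ t) ≤ 2 := by
  have hρ := r.rho_pos
  have hK := r.two_le
  have h0 := r.nonneg
  have h1 : K / ρ * a₀ * geoSum η₀ t ≤ Real.log 2 := by
    have := mul_le_mul_of_nonneg_left (geoSum_le r.one_le_eta t)
      (by positivity : 0 ≤ K / ρ * a₀)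
    refine this.trans ?_
    have : K / ρ * a₀ * (2 * η₀) = 2 * K * a₀ * η₀ / ρ := by ring
    rw [this, div_le_iff₀ hρ]
    exact r.small
  calc _ ≤ Real.exp (Real.log 2) := Real.exp_le_exp.mpr h1
    _ = 2 := Real.exp_log two_pos

/-- Deterministic bound on the (expected) potential after `t` steps. -/
noncomputable def potentialBound (K ρ η₀ a₀ : ℝ) (t : ℕ) : ℝ :=
  ρ ^ t * (K * η₀) * Real.exp (K / ρ * a₀ * geoSum η₀ t)

theorem Rates.potentialBound_nonneg {K ρ η₀ a₀ : ℝ} (r : Rates K ρ η₀ a₀) (t : ℕ) :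
    0 ≤ potentialBound K ρ η₀ a₀ t := by
  have := r.rho_pos; have := r.two_le; have := r.one_le_eta
  unfold potentialBound
  positivity

theorem Rates.potentialBound_le {K ρ η₀ a₀ : ℝ} (r : Rates K ρ η₀ a₀) (t : ℕ) :
    potentialBound K ρ η₀ a₀ t ≤ 2 * K * η₀ * ρ ^ t := by
  have h1 := r.rho_pos; have := r.two_le; have := r.one_le_eta
  have := mul_le_mul_of_nonneg_left (r.exp_growth_le t) (by positivity : 0 ≤ ρ ^ t * (K * η₀))
  unfold potentialBound
  linarith

/-- The factor satisfies `ρ + K a ≤ ρ exp(K a / ρ)`, so the perturbations add up in the exponent. -/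
theorem Rates.mul_potentialBound_le {K ρ η₀ a₀ : ℝ} (r : Rates K ρ η₀ a₀) {a : ℝ} {t : ℕ}
    (ha : a ≤ a₀ * (1 - 1 / (2 * η₀)) ^ t) :
    (ρ + K * a) * potentialBound K ρ η₀ a₀ t ≤ potentialBound K ρ η₀ a₀ (t + 1) := by
  have hρ := r.rho_pos
  have hK := r.two_le
  have h1 : ρ + K * a ≤ ρ * Real.exp (K / ρ * a₀ * (1 - 1 / (2 * η₀)) ^ t) := by
    have h2 := Real.add_one_le_exp (K / ρ * a₀ * (1 - 1 / (2 * η₀)) ^ t)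
    have h3 : K * a ≤ K * (a₀ * (1 - 1 / (2 * η₀)) ^ t) :=
      mul_le_mul_of_nonneg_left ha (by linarith)
    have h4 := mul_le_mul_of_nonneg_left h2 hρ.le
    have h5 : ρ * (K / ρ * a₀ * (1 - 1 / (2 * η₀)) ^ t + 1) =
        K * (a₀ * (1 - 1 / (2 * η₀)) ^ t) + ρ := by field_simp
    linarith
  refine (mul_le_mul_of_nonneg_right h1 (r.potentialBound_nonneg t)).trans (le_of_eq ?_)
  unfold potentialBound
  rw [geoSum_succ, mul_add, Real.exp_add, pow_succ]
  ring

end Scalar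

/-! ### Trajectories of the method -/

section Trajectory

variable {d k : ℕ} {L μ M η₀ : ℝ} {f : EuclideanSpace ℝ (Fin d) → ℝ}
  {x₀ : EuclideanSpace ℝ (Fin d)} {G₀ : Matrix (Fin d) (Fin d) ℝ}

/-- A trace bound for the quadratic form of a positive semidefinite matrix. -/
theorem quad_le_trace {A : Matrix (Fin d) (Fin d) ℝ} (hA : A.PosSemidef)
    (v : EuclideanSpace ℝ (Fin d)) : v.ofLp ⬝ᵥ A *ᵥ v.ofLp ≤ A.trace * ‖v‖ ^ 2 := by
  obtain ⟨C, rfl⟩ := exists_eq_transpose_mul_self hA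
  have e1 : v.ofLp ⬝ᵥ (Cᵀ * C) *ᵥ v.ofLp = ∑ i, (∑ j, C i j * v j) ^ 2 := by
    rw [← mulVec_mulVec, dotProduct_mulVec, vecMul_transpose]
    simp [dotProduct, mulVec, sq]
  have e2 : (Cᵀ * C).trace = ∑ i, ∑ j, C i j ^ 2 := by
    rw [Finset.sum_comm]
    simp [trace, Matrix.mul_apply, sq]
  have e3 : ‖v‖ ^ 2 = ∑ j, v j ^ 2 := by
    rw [EuclideanSpace.norm_sq_eq]; simp
  rw [e1, e2, e3, Finset.sum_mul]
  exact Finset.sum_le_sum fun i _ => Finset.sum_mul_sq_le_sq_mul_sq _ _ _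

/-- The normalized trace gap `tr(G - ∇²f(x)) / μ`. -/
noncomputable def gap (f : EuclideanSpace ℝ (Fin d) → ℝ) (μ : ℝ)
    (z : EuclideanSpace ℝ (Fin d) × Matrix (Fin d) (Fin d) ℝ) : ℝ :=
  (z.2 - hess f z.1).trace / μ

theorem Objective.gap_nonneg (h : Objective L μ M f)
    {z : EuclideanSpace ℝ (Fin d) × Matrix (Fin d) (Fin d) ℝ} (hz : Loewner (hess f z.1) z.2) :
    0 ≤ gap f μ z :=
  div_nonneg (PosSemidef.trace_nonneg hz) h.mu_pos.le

/-- A positive semidefinite matrix is at most its trace times the identity, and strong convexity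
bounds the identity by `∇²f(x) / μ`. -/
theorem Objective.loewner_gap (h : Objective L μ M f)
    {z : EuclideanSpace ℝ (Fin d) × Matrix (Fin d) (Fin d) ℝ} (hz : Loewner (hess f z.1) z.2) :
    Loewner z.2 ((1 + gap f μ z) • hess f z.1) := by
  have hG := transpose_eq_of_posSemidef (h.posDef_of_hess_le hz).posSemidef
  have hH := hess_transpose h.twiceDiff z.1
  rw [Loewner, posSemidef_iff_real]
  refine ⟨by rw [transpose_sub, transpose_smul, hG, hH], fun v => ?_⟩
  have h1 := quad_le_trace hz (WithLp.toLp 2 v)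
  have h2 := mul_le_mul_of_nonneg_left (h.hess_lower z.1 (WithLp.toLp 2 v)) (h.gap_nonneg hz)
  have h3 : gap f μ z * (μ * ‖WithLp.toLp 2 v‖ ^ 2) =
      (z.2 - hess f z.1).trace * ‖WithLp.toLp 2 v‖ ^ 2 := by
    have := h.mu_pos.ne'
    unfold gap; field_simp
  simp only [sub_mulVec, dotProduct_sub, add_smul, one_smul, add_mulVec, smul_mulVec,
    dotProduct_add, dotProduct_smul, smul_eq_mul] at h1 h2 ⊢
  linarith

theorem Objective.gap_le (h : Objective L μ M f) (hη : 1 ≤ η₀)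
    {z : EuclideanSpace ℝ (Fin d) × Matrix (Fin d) (Fin d) ℝ}
    (hz : Loewner z.2 (η₀ • hess f z.1)) : gap f μ z ≤ (η₀ - 1) * (d * (L / μ)) := by
  have h1 := PosSemidef.trace_nonneg hz
  have h2 := mul_le_mul_of_nonneg_left (h.trace_hess_le z.1) (by linarith : 0 ≤ η₀ - 1)
  rw [gap, div_le_iff₀ h.mu_pos, mul_assoc, mul_assoc, div_mul_cancel₀ _ h.mu_pos.ne']
  simp only [trace_sub, trace_smul, smul_eq_mul] at h1 ⊢
  linarith

theorem Objective.loewner_smul_mono (h : Objective L μ M f) {x : EuclideanSpace ℝ (Fin d)}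
    {G : Matrix (Fin d) (Fin d) ℝ} {a b : ℝ} (hab : a ≤ b) (hG : Loewner G (a • hess f x)) :
    Loewner G (b • hess f x) := by
  have h1 := PosSemidef.smul (h.hess_posDef x).posSemidef (sub_nonneg.mpr hab)
  rw [Loewner] at hG ⊢
  convert hG.add h1 using 1
  module

/-- The hypotheses on the objective, the parameters and the starting point of the method. -/
structure Start (k : ℕ) (L μ M η₀ : ℝ) (f : EuclideanSpace ℝ (Fin d) → ℝ)
    (x₀ : EuclideanSpace ℝ (Fin d)) (G₀ : Matrix (Fin d) (Fin d) ℝ) : Prop where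
  objective : Objective L μ M f
  one_le_k : 1 ≤ k
  k_lt_d : k < d
  one_le_eta : 1 ≤ η₀
  init : M * lam f x₀ ≤ Real.log 2 / 2 * (((d : ℝ) - k) / (η₀ * (d : ℝ) ^ 2 * (L / μ)))
  lower : Loewner (hess f x₀) G₀
  upper : Loewner G₀ (η₀ • hess f x₀)

/-- The initial condition on `λ(x₀)` is `2 K a₀ η₀ ≤ ρ log 2` after clearing denominators. -/
theorem Start.rates (h : Start k L μ M η₀ f x₀ G₀) :
    Rates (d * (L / μ)) (1 - (k : ℝ) / d) η₀ (M * lam f x₀) := by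
  have hμ := h.objective.mu_pos
  have hκ : 1 ≤ L / μ := (one_le_div hμ).mpr h.objective.mu_le_L
  have hk : (1 : ℝ) ≤ k := by exact_mod_cast h.one_le_k
  have hkd : (k : ℝ) + 1 ≤ d := by exact_mod_cast h.k_lt_d
  have hd : (2 : ℝ) ≤ d := by linarith
  have hd0 : (d : ℝ) ≠ 0 := by linarith
  have hdK : (d : ℝ) ≤ d * (L / μ) := le_mul_of_one_le_right (by linarith) hκ
  have hη := h.one_le_eta
  have hρ : (1 - (k : ℝ) / d) * d = d - k := by field_simp
  refine ⟨by linarith, ?_, ?_, ?_, ?_, hη, mul_nonneg h.objective.M_nonneg (lam_nonneg _), ?_⟩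
  · rw [sub_pos, div_lt_one (by linarith)]; linarith
  · have : 0 ≤ (k : ℝ) / d := by positivity
    linarith
  · refine le_trans ?_ hdK
    refine le_of_mul_le_mul_right (a := (d : ℝ)) ?_ (by linarith)
    rw [mul_assoc, hρ]
    -- As `k ≥ 1`, the claim follows from `4(d - 1) ≤ d²`.
    nlinarith [sq_nonneg ((d : ℝ) - 2)]
  · rw [sub_sub_cancel]
    have : (k : ℝ) / d * (d * (L / μ)) = k * (L / μ) := by field_simp
    rw [this]
    nlinarith
  · have hK : 0 < 2 * (d * (L / μ)) * η₀ := by positivity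
    calc 2 * (d * (L / μ)) * (M * lam f x₀) * η₀ = 2 * (d * (L / μ)) * η₀ * (M * lam f x₀) := by
          ring
      _ ≤ 2 * (d * (L / μ)) * η₀ *
          (Real.log 2 / 2 * (((d : ℝ) - k) / (η₀ * (d : ℝ) ^ 2 * (L / μ)))) :=
          mul_le_mul_of_nonneg_left h.init hK.le
      _ = Real.log 2 * (1 - (k : ℝ) / d) := by
          have : L ≠ 0 := (hμ.trans_le h.objective.mu_le_L).ne'
          have : η₀ ≠ 0 := by linarith
          field_simp

theorem Start.loewner_run (h : Start k L μ M η₀ f x₀ G₀) (U : ℕ → Matrix (Fin d) (Fin k) ℝ)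
    (t : ℕ) : Loewner (hess f (run f M x₀ G₀ U t).1) (run f M x₀ G₀ U t).2 := by
  induction t with
  | zero => exact h.lower
  | succ t ih => rw [run_succ]; exact h.objective.step_lower ih _

theorem lamAt_succ (U : ℕ → Matrix (Fin d) (Fin k) ℝ) (t : ℕ) :
    lamAt f M x₀ G₀ U (t + 1) =
      lam f (nextPoint f (run f M x₀ G₀ U t).1 (run f M x₀ G₀ U t).2) := rfl

theorem lamAt_nonneg (U : ℕ → Matrix (Fin d) (Fin k) ℝ) (t : ℕ) :
    0 ≤ lamAt f M x₀ G₀ U t := lam_nonneg _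

theorem beta_pow_le_one (hη : 1 ≤ η₀) (t : ℕ) : (1 - 1 / (2 * η₀)) ^ t ≤ 1 :=
  pow_le_one₀ (beta_bounds hη).1 (beta_bounds hη).2.le

/-- The trajectory stays in the region of linear convergence. -/
theorem Start.linear_aux (h : Start k L μ M η₀ f x₀ G₀) (U : ℕ → Matrix (Fin d) (Fin k) ℝ)
    (t : ℕ) : lamAt f M x₀ G₀ U t ≤ (1 - 1 / (2 * η₀)) ^ t * lam f x₀ ∧
      Loewner (run f M x₀ G₀ U t).2
        ((η₀ * Real.exp (2 * (M * lam f x₀) * geoSum η₀ t)) • hess f (run f M x₀ G₀ U t).1) ∧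
      lamAt f M x₀ G₀ U (t + 1) ≤ (1 - 1 / (2 * η₀)) * lamAt f M x₀ G₀ U t := by
  have r := h.rates
  have hη := h.one_le_eta
  have hM := h.objective.M_nonneg
  obtain ⟨hβ0, hβ1⟩ := beta_bounds hη
  have hstep : ∀ t, lamAt f M x₀ G₀ U t ≤ (1 - 1 / (2 * η₀)) ^ t * lam f x₀ →
      Loewner (run f M x₀ G₀ U t).2
        ((η₀ * Real.exp (2 * (M * lam f x₀) * geoSum η₀ t)) • hess f (run f M x₀ G₀ U t).1) →
      lamAt f M x₀ G₀ U (t + 1) ≤ (1 - 1 / (2 * η₀)) * lamAt f M x₀ G₀ U t := by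
    intro t h1 h2
    have ha : M * lamAt f M x₀ G₀ U t ≤ M * lam f x₀ := by
      refine mul_le_mul_of_nonneg_left (h1.trans ?_) hM
      exact mul_le_of_le_one_left (lam_nonneg _) (beta_pow_le_one hη t)
    have h3 := h.objective.loewner_smul_mono
      (mul_le_mul_of_nonneg_left (r.exp_eta_le t) (by linarith : 0 ≤ η₀)) h2
    have ha' := r.a₀_le_one_fifth
    rw [lamAt_succ]
    refine (h.objective.lam_nextPoint_le (by linarith) (h.loewner_run U t) h3
      (by rw [lamAt] at ha; linarith)).trans ?_
    refine mul_le_mul_of_nonneg_right ?_ (lam_nonneg _)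
    -- With `G ⪯ (3/2) η₀ ∇²f(x)`, the factor is at most `1 - (2/3 - 11/100)/η₀`, which is below `1
    -- - 1/(2η₀)`.
    have h4 : M * lam f x₀ ≤ 1 / 10 / η₀ := by
      rw [le_div_iff₀ (by linarith)]
      have := r.a₀_le; have := Real.log_two_lt_d9
      linarith
    have e1 : 1 / (η₀ * (3 / 2)) = 2 / 3 * (1 / η₀) := by field_simp
    have e2 : 1 / (2 * η₀) = 1 / 2 * (1 / η₀) := by field_simp
    have e3 : 1 / 10 / η₀ = 1 / 10 * (1 / η₀) := by field_simp
    have : 0 ≤ 1 / η₀ := by positivity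
    rw [lamAt] at ha
    rw [e1, e2]
    linarith
  induction t with
  | zero =>
    have h1 : lamAt f M x₀ G₀ U 0 ≤ (1 - 1 / (2 * η₀)) ^ 0 * lam f x₀ := by
      simp [lamAt, run]
    have h2 : Loewner (run f M x₀ G₀ U 0).2
        ((η₀ * Real.exp (2 * (M * lam f x₀) * geoSum η₀ 0)) • hess f (run f M x₀ G₀ U 0).1) := by
      simpa [geoSum, run] using h.upper
    exact ⟨h1, h2, hstep 0 h1 h2⟩
  | succ t ih =>
    obtain ⟨i1, i2, i3⟩ := ih
    have h1 : lamAt f M x₀ G₀ U (t + 1) ≤ (1 - 1 / (2 * η₀)) ^ (t + 1) * lam f x₀ := by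
      rw [pow_succ', mul_assoc]
      exact i3.trans (mul_le_mul_of_nonneg_left i1 hβ0)
    have h2 : Loewner (run f M x₀ G₀ U (t + 1)).2
        ((η₀ * Real.exp (2 * (M * lam f x₀) * geoSum η₀ (t + 1))) •
          hess f (run f M x₀ G₀ U (t + 1)).1) := by
      rw [run_succ]
      refine h.objective.loewner_smul_mono ?_
        (h.objective.step_upper (by positivity) (h.loewner_run U t) i2 (U t))
      have ha : M * lamAt f M x₀ G₀ U t ≤ M * lam f x₀ * (1 - 1 / (2 * η₀)) ^ t := by
        have := mul_le_mul_of_nonneg_left i1 hM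
        linarith
      -- Each step multiplies the upper ratio by `(1 + a_t)² ≤ exp(2 a_t)`, and the linear decay of
      -- `a_t` makes the exponents a geometric sum.
      have e1 : (1 + M * lamAt f M x₀ G₀ U t) ^ 2 ≤
          Real.exp (2 * (M * lam f x₀) * (1 - 1 / (2 * η₀)) ^ t) := by
        have h0 : 0 ≤ M * lamAt f M x₀ G₀ U t := mul_nonneg hM (lamAt_nonneg _ _)
        have e2 := Real.add_one_le_exp (M * lam f x₀ * (1 - 1 / (2 * η₀)) ^ t)
        calc _ ≤ Real.exp (M * lam f x₀ * (1 - 1 / (2 * η₀)) ^ t) ^ 2 :=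
              pow_le_pow_left₀ (by linarith) (by linarith) 2
          _ = _ := by rw [← Real.exp_nat_mul]; congr 1; push_cast; ring
      rw [geoSum_succ, mul_add, Real.exp_add]
      have e3 : (1 + M * lam f (run f M x₀ G₀ U t).1) ^ 2 ≤ _ := e1
      calc _ ≤ Real.exp (2 * (M * lam f x₀) * (1 - 1 / (2 * η₀)) ^ t) *
            (η₀ * Real.exp (2 * (M * lam f x₀) * geoSum η₀ t)) :=
            mul_le_mul_of_nonneg_right e3 (by positivity)
        _ = _ := by ring
    exact ⟨h1, h2, hstep _ h1 h2⟩

theorem Start.lamAt_le (h : Start k L μ M η₀ f x₀ G₀) (U : ℕ → Matrix (Fin d) (Fin k) ℝ)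
    (t : ℕ) : lamAt f M x₀ G₀ U t ≤ (1 - 1 / (2 * η₀)) ^ t * lam f x₀ := (h.linear_aux U t).1

theorem Start.mul_lamAt_le (h : Start k L μ M η₀ f x₀ G₀) (U : ℕ → Matrix (Fin d) (Fin k) ℝ)
    (t : ℕ) : M * lamAt f M x₀ G₀ U t ≤ M * lam f x₀ * (1 - 1 / (2 * η₀)) ^ t := by
  have := mul_le_mul_of_nonneg_left (h.lamAt_le U t) h.objective.M_nonneg
  linarith

theorem Start.mul_lamAt_le_init (h : Start k L μ M η₀ f x₀ G₀)
    (U : ℕ → Matrix (Fin d) (Fin k) ℝ) (t : ℕ) : M * lamAt f M x₀ G₀ U t ≤ M * lam f x₀ :=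
  (h.mul_lamAt_le U t).trans (mul_le_of_le_one_right
    (mul_nonneg h.objective.M_nonneg (lam_nonneg _)) (beta_pow_le_one h.one_le_eta t))

/-- The contraction factor `λ(x_{t+1}) / λ(x_t)`. -/
noncomputable def ratio (f : EuclideanSpace ℝ (Fin d) → ℝ) (M : ℝ)
    (x₀ : EuclideanSpace ℝ (Fin d)) (G₀ : Matrix (Fin d) (Fin d) ℝ)
    (U : ℕ → Matrix (Fin d) (Fin k) ℝ) (t : ℕ) : ℝ :=
  lamAt f M x₀ G₀ U (t + 1) / lamAt f M x₀ G₀ U t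

theorem ratio_nonneg (U : ℕ → Matrix (Fin d) (Fin k) ℝ) (t : ℕ) :
    0 ≤ ratio f M x₀ G₀ U t := div_nonneg (lamAt_nonneg _ _) (lamAt_nonneg _ _)

/-- Division by zero gives zero, the stated convention; linear convergence shows that `λ` remains
zero once it vanishes. -/
theorem Start.lamAt_succ_eq (h : Start k L μ M η₀ f x₀ G₀) (U : ℕ → Matrix (Fin d) (Fin k) ℝ)
    (t : ℕ) : lamAt f M x₀ G₀ U (t + 1) = ratio f M x₀ G₀ U t * lamAt f M x₀ G₀ U t := by
  by_cases h0 : lamAt f M x₀ G₀ U t = 0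
  · have := (h.linear_aux U t).2.2
    rw [h0, mul_zero] at this ⊢
    exact le_antisymm this (lamAt_nonneg _ _)
  · rw [ratio, div_mul_cancel₀ _ h0]

theorem Start.ratio_le_one (h : Start k L μ M η₀ f x₀ G₀) (U : ℕ → Matrix (Fin d) (Fin k) ℝ)
    (t : ℕ) : ratio f M x₀ G₀ U t ≤ 1 := by
  refine div_le_one_of_le₀ ((h.linear_aux U t).2.2.trans ?_) (lamAt_nonneg _ _)
  exact mul_le_of_le_one_left (lamAt_nonneg _ _) (beta_bounds h.one_le_eta).2.le

/-- The potential of a state `(x, G)`. -/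
noncomputable def statePotential (k : ℕ) (L μ M η₀ : ℝ) (f : EuclideanSpace ℝ (Fin d) → ℝ)
    (z : EuclideanSpace ℝ (Fin d) × Matrix (Fin d) (Fin d) ℝ) : ℝ :=
  potential (d * (L / μ)) (weight (d * (L / μ)) (1 - (k : ℝ) / d) η₀) (M * lam f z.1) (gap f μ z)

theorem Objective.lam_nextPoint_le_gap (h : Objective L μ M f)
    {z : EuclideanSpace ℝ (Fin d) × Matrix (Fin d) (Fin d) ℝ} (hz : Loewner (hess f z.1) z.2)
    (ha : M * lam f z.1 ≤ 2 / 5) :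
    lam f (nextPoint f z.1 z.2) ≤
      (gap f μ z / (1 + gap f μ z) + 11 / 10 * (M * lam f z.1)) * lam f z.1 := by
  have h0 := h.gap_nonneg hz
  have := h.lam_nextPoint_le (by linarith) hz (h.loewner_gap hz) ha
  have e : 1 - 1 / (1 + gap f μ z) = gap f μ z / (1 + gap f μ z) := by
    field_simp; ring
  rwa [e] at this

/-- The ratio is at most `s + 11a/10`, and the potential dominates this because `2K ≥ 4`. -/
theorem Start.ratio_le_potential (h : Start k L μ M η₀ f x₀ G₀)
    (U : ℕ → Matrix (Fin d) (Fin k) ℝ) (t : ℕ) :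
    ratio f M x₀ G₀ U t ≤ statePotential k L μ M η₀ f (run f M x₀ G₀ U t) := by
  have r := h.rates
  have hz := h.loewner_run U t
  have h0 := h.objective.gap_nonneg hz
  have ha := h.mul_lamAt_le_init U t
  have ha0 : 0 ≤ M * lamAt f M x₀ G₀ U t := mul_nonneg h.objective.M_nonneg (lamAt_nonneg _ _)
  have h1 := h.objective.lam_nextPoint_le_gap hz
    (by rw [lamAt] at ha; linarith [r.a₀_le_one_fifth])
  set s := gap f μ (run f M x₀ G₀ U t)
  have h2 : ratio f M x₀ G₀ U t ≤ s / (1 + s) + 11 / 10 * (M * lamAt f M x₀ G₀ U t) :=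
    div_le_of_le_mul₀ (lamAt_nonneg _ _) (by positivity) h1
  have h3 : s / (1 + s) ≤ s := div_le_self h0 (by linarith)
  have h4 := r.two_le
  have h5 := r.weight_pos
  have h6 : 0 ≤ weight (d * (L / μ)) (1 - (k : ℝ) / d) η₀ * (M * lamAt f M x₀ G₀ U t) * s := by
    positivity
  have h7 : 11 / 10 * (M * lamAt f M x₀ G₀ U t) ≤
      2 * (d * (L / μ)) * (M * lamAt f M x₀ G₀ U t) :=
    mul_le_mul_of_nonneg_right (by linarith) ha0
  unfold statePotential potential
  rw [lamAt] at *
  linarith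

theorem Start.statePotential_nonneg (h : Start k L μ M η₀ f x₀ G₀)
    {z : EuclideanSpace ℝ (Fin d) × Matrix (Fin d) (Fin d) ℝ} (hz : Loewner (hess f z.1) z.2) :
    0 ≤ statePotential k L μ M η₀ f z := by
  have r := h.rates
  have h0 := h.objective.gap_nonneg hz
  have ha0 : 0 ≤ M * lam f z.1 := mul_nonneg h.objective.M_nonneg (lam_nonneg _)
  have := r.two_le
  have := r.weight_pos
  unfold statePotential potential
  positivity

theorem Start.statePotential_zero (h : Start k L μ M η₀ f x₀ G₀) :
    statePotential k L μ M η₀ f (x₀, G₀) ≤ potentialBound (d * (L / μ)) (1 - (k : ℝ) / d) η₀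
      (M * lam f x₀) 0 := by
  have := h.rates.potential_zero (a := M * lam f x₀)
    (mul_nonneg h.objective.M_nonneg (lam_nonneg _)) le_rfl
    (h.objective.gap_le h.one_le_eta (z := (x₀, G₀)) h.upper)
  simpa [statePotential, potentialBound, geoSum] using this

/-- Decrease of the potential when the gap after the step is replaced by any bound `s'` at most
`1 - k/d` times the trace of the residual; `s'` may be an average over the directions. -/
theorem Start.potential_le (h : Start k L μ M η₀ f x₀ G₀)
    {z : EuclideanSpace ℝ (Fin d) × Matrix (Fin d) (Fin d) ℝ} (hz : Loewner (hess f z.1) z.2)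
    (ha : M * lam f z.1 ≤ M * lam f x₀) {s' : ℝ}
    (hs' : s' ≤ (1 - (k : ℝ) / d) * ((residual f M z.1 z.2).trace / μ)) :
    potential (d * (L / μ)) (weight (d * (L / μ)) (1 - (k : ℝ) / d) η₀)
        (M * lam f (nextPoint f z.1 z.2)) s' ≤
      (1 - (k : ℝ) / d + d * (L / μ) * (M * lam f z.1)) * statePotential k L μ M η₀ f z := by
  have r := h.rates
  have hM := h.objective.M_nonneg
  have hμ := h.objective.mu_pos
  refine r.potential_step (mul_nonneg hM (lam_nonneg _)) ha (h.objective.gap_nonneg hz)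
    (mul_nonneg hM (lam_nonneg _)) ?_ (hs'.trans (mul_le_mul_of_nonneg_left ?_ r.rho_pos.le))
  · have := mul_le_mul_of_nonneg_left (h.objective.lam_nextPoint_le_gap hz
      (by linarith [r.a₀_le_one_fifth])) hM
    linarith
  · rw [div_le_iff₀ hμ]
    refine (h.objective.trace_residual_le hz).trans (le_of_eq ?_)
    unfold gap
    field_simp

end Trajectory

/-! ### The greedy strategy -/

section Greedy

variable {d k : ℕ} {L μ M η₀ : ℝ} {f : EuclideanSpace ℝ (Fin d) → ℝ}
  {x₀ : EuclideanSpace ℝ (Fin d)} {G₀ : Matrix (Fin d) (Fin d) ℝ}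

/-- The `k` largest diagonal entries carry at least the fraction `k / d` of the trace. -/
theorem IsTopDiag.trace_le {A : Matrix (Fin d) (Fin d) ℝ} {U : Matrix (Fin d) (Fin k) ℝ}
    (hA : A.PosSemidef) (hU : IsTopDiag A U) (hd : 0 < d) :
    (A - reduction A U).trace ≤ (1 - (k : ℝ) / d) * A.trace := by
  obtain ⟨s, hs, htop, rfl⟩ := hU
  set U : Matrix (Fin d) (Fin k) ℝ := Matrix.of fun i j => if i = s j then (1 : ℝ) else 0 with hU
  have hUU : Uᵀ * U = 1 := by
    ext i j
    simp [hU, Matrix.mul_apply, Matrix.one_apply, hs.eq_iff, eq_comm]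
  have hred := trace_rangeProj_mul_le_trace_reduction hA U
  have h1 : (rangeProj U * A).trace = ∑ j, A (s j) (s j) := by
    rw [rangeProj, hUU, inv_one, Matrix.mul_one, Matrix.mul_assoc, trace_mul_comm]
    simp [trace, Matrix.mul_apply, hU]
  have h2 : (k : ℝ) * A.trace ≤ d * ∑ j, A (s j) (s j) := by
    classical
    set T : Finset (Fin d) := Finset.univ.image s with hT
    have hcard : T.card = k := by rw [hT, Finset.card_image_of_injective _ hs]; simp
    have hsum : ∑ j, A (s j) (s j) = ∑ i ∈ T, A i i := by
      rw [hT, Finset.sum_image hs.injOn]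
    have hle : ∀ i ∈ Tᶜ, ∀ j ∈ T, A i i ≤ A j j := by
      intro i hi j hj
      obtain ⟨j', -, rfl⟩ := Finset.mem_image.mp hj
      refine htop j' i ?_
      rintro ⟨l, rfl⟩
      simp [hT] at hi
    -- Every unselected diagonal entry is at most every selected one; the inequality is summed over
    -- all `k (d - k)` pairs.
    have h3 : (k : ℝ) * ∑ i ∈ Tᶜ, A i i ≤ (d - k) * ∑ j ∈ T, A j j := by
      have : ∑ j ∈ T, ∑ i ∈ Tᶜ, A i i ≤ ∑ j ∈ T, ∑ i ∈ Tᶜ, A j j :=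
        Finset.sum_le_sum fun j hj => Finset.sum_le_sum fun i hi => hle i hi j hj
      have hc : (Tᶜ.card : ℝ) = d - k := by
        have := Finset.card_compl_add_card T
        rw [hcard, Fintype.card_fin] at this
        rw [eq_sub_iff_add_eq]; exact_mod_cast this
      simpa [hcard, hc, Finset.mul_sum] using this
    have h4 : A.trace = ∑ i ∈ T, A i i + ∑ i ∈ Tᶜ, A i i := by
      rw [Finset.sum_add_sum_compl]; rfl
    rw [hsum, h4]
    linarith
  have hd' : (0 : ℝ) < d := by exact_mod_cast hd
  have h5 : (k : ℝ) / d * A.trace ≤ (rangeProj U * A).trace := by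
    rw [h1, div_mul_eq_mul_div, div_le_iff₀ hd']; linarith
  rw [trace_sub]
  linarith

/-- Induction: the step factor is `ρ + K a_t`, and the deterministic decay of `a_t` fits it into the
next bound. -/
theorem Start.greedy_potential_le (h : Start k L μ M η₀ f x₀ G₀)
    {U : ℕ → Matrix (Fin d) (Fin k) ℝ} (hU : IsGreedy f M x₀ G₀ U) (t : ℕ) :
    statePotential k L μ M η₀ f (run f M x₀ G₀ U t) ≤
      potentialBound (d * (L / μ)) (1 - (k : ℝ) / d) η₀ (M * lam f x₀) t := by
  have r := h.rates
  induction t with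
  | zero => exact h.statePotential_zero
  | succ t ih =>
    have hz := h.loewner_run U t
    have hs : gap f μ (run f M x₀ G₀ U (t + 1)) ≤ (1 - (k : ℝ) / d) *
        ((residual f M (run f M x₀ G₀ U t).1 (run f M x₀ G₀ U t).2).trace / μ) := by
      rw [gap, run_succ, step_snd_sub, ← mul_div_assoc]
      refine div_le_div_of_nonneg_right ?_ h.objective.mu_pos.le
      exact IsTopDiag.trace_le (h.objective.residual_posSemidef hz) (hU t) h.objective.dim_pos
    refine (h.potential_le hz (h.mul_lamAt_le_init U t) hs).trans ?_
    refine le_trans (mul_le_mul_of_nonneg_left ih ?_) (r.mul_potentialBound_le (h.mul_lamAt_le U t))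
    have := r.rho_pos; have := r.two_le
    have : 0 ≤ M * lam f (run f M x₀ G₀ U t).1 := mul_nonneg h.objective.M_nonneg (lam_nonneg _)
    positivity

theorem Start.greedy_ratio_le (h : Start k L μ M η₀ f x₀ G₀)
    {U : ℕ → Matrix (Fin d) (Fin k) ℝ} (hU : IsGreedy f M x₀ G₀ U) (t : ℕ) :
    ratio f M x₀ G₀ U t ≤ 2 * d * (L / μ) * η₀ * (1 - (k : ℝ) / d) ^ t := by
  have := (h.ratio_le_potential U t).trans
    ((h.greedy_potential_le hU t).trans (h.rates.potentialBound_le t))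
  linarith

/-- Superlinear convergence from a superlinear bound on the contraction factors. -/
theorem Start.lamAt_le_of_ratio_le (h : Start k L μ M η₀ f x₀ G₀)
    (U : ℕ → Matrix (Fin d) (Fin k) ℝ) {c : ℝ} (hc : 0 ≤ c) (t₀ : ℕ)
    (hq : ∀ t, ratio f M x₀ G₀ U (t₀ + t) ≤ c ^ t * (1 / 2)) (t : ℕ) :
    lamAt f M x₀ G₀ U (t₀ + t) ≤
      c ^ (t * (t - 1) / 2) * (1 / 2 : ℝ) ^ t * (1 - 1 / (2 * η₀)) ^ t₀ * lam f x₀ := by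
  induction t with
  | zero => simpa using h.lamAt_le U t₀
  | succ t ih =>
    rw [← add_assoc, h.lamAt_succ_eq]
    refine (mul_le_mul (hq t) ih (lamAt_nonneg _ _) (by positivity)).trans (le_of_eq ?_)
    -- Going through the sum `0 + ... + (t-1)` avoids a parity argument for natural number division.
    have e : (t + 1) * (t + 1 - 1) / 2 = t * (t - 1) / 2 + t := by
      rw [← Finset.sum_range_id_mul_two, ← Finset.sum_range_id_mul_two,
        Nat.mul_div_cancel _ two_pos, Nat.mul_div_cancel _ two_pos, Finset.sum_range_succ]
    rw [e, pow_add, pow_succ (1 / 2 : ℝ)]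
    ring

/-- `ρ ^ t ≤ c` once `t ≥ (d / k) log (1 / c)`. -/
theorem Start.rho_pow_le (h : Start k L μ M η₀ f x₀ G₀) {c : ℝ} (hc : 0 < c) {t : ℕ}
    (ht : d * Real.log c⁻¹ / k ≤ t) : (1 - (k : ℝ) / d) ^ t ≤ c := by
  have hk : (0 : ℝ) < k := by exact_mod_cast h.one_le_k
  have hd : (0 : ℝ) < d := by exact_mod_cast h.objective.dim_pos
  have h1 : 1 - (k : ℝ) / d ≤ Real.exp (-(k / d)) := by
    have := Real.add_one_le_exp (-((k : ℝ) / d)); linarith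
  calc (1 - (k : ℝ) / d) ^ t ≤ Real.exp (-(k / d)) ^ t :=
        pow_le_pow_left₀ h.rates.rho_pos.le h1 t
    _ = Real.exp (t * -(k / d)) := (Real.exp_nat_mul _ _).symm
    _ ≤ Real.exp (Real.log c) := by
        apply Real.exp_le_exp.mpr
        rw [Real.log_inv, div_le_iff₀ hk] at ht
        have : (t : ℝ) * (k / d) = t * k / d := by ring
        rw [mul_neg, neg_le, this, le_div_iff₀ hd]
        linarith
    _ = c := Real.exp_log hc

/-- With `B = η₀ d ϰ ≥ 2`, it is enough that `ρ^{t₀} ≤ 1/(4B)`, and `4B ≤ B^5` accounts for the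
constant `5`. -/
theorem Start.greedy_lamAt_le (h : Start k L μ M η₀ f x₀ G₀)
    {U : ℕ → Matrix (Fin d) (Fin k) ℝ} (hU : IsGreedy f M x₀ G₀ U) {t₀ : ℕ}
    (ht₀ : 5 * (d * Real.log (η₀ * d * (L / μ)) / k) ≤ t₀) (t : ℕ) :
    lamAt f M x₀ G₀ U (t₀ + t) ≤ (1 - (k : ℝ) / d) ^ (t * (t - 1) / 2) * (1 / 2 : ℝ) ^ t *
      (1 - 1 / (2 * η₀)) ^ t₀ * lam f x₀ := by
  have r := h.rates
  have hρ := r.rho_pos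
  have hη := r.one_le_eta
  have hK := r.two_le
  refine h.lamAt_le_of_ratio_le U hρ.le t₀ (fun t => ?_) t
  obtain ⟨B, hB⟩ : ∃ B, B = η₀ * d * (L / μ) := ⟨_, rfl⟩
  have hB2 : 2 ≤ B := by
    rw [hB, mul_assoc]; nlinarith
  have h1 : (1 - (k : ℝ) / d) ^ t₀ ≤ (4 * B)⁻¹ := by
    refine h.rho_pow_le (by positivity) (le_trans ?_ ht₀)
    rw [inv_inv, ← hB, mul_div_assoc', mul_left_comm]
    refine div_le_div_of_nonneg_right (mul_le_mul_of_nonneg_left ?_ (by positivity))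
      (by positivity)
    have : (5 : ℝ) * Real.log B = Real.log (B ^ 5) := by rw [Real.log_pow]; norm_num
    rw [this]
    refine Real.log_le_log (by positivity) ?_
    have : (4 : ℝ) ≤ B ^ 4 := by
      calc (4 : ℝ) ≤ 2 ^ 4 := by norm_num
        _ ≤ B ^ 4 := pow_le_pow_left₀ (by norm_num) hB2 4
    calc 4 * B ≤ B ^ 4 * B := mul_le_mul_of_nonneg_right this (by linarith)
      _ = B ^ 5 := by ring
  have h2 := h.greedy_ratio_le hU (t₀ + t)
  have e : 2 * d * (L / μ) * η₀ * (1 - (k : ℝ) / d) ^ (t₀ + t) =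
      2 * B * (1 - (k : ℝ) / d) ^ t * (1 - (k : ℝ) / d) ^ t₀ := by
    rw [hB, pow_add]; ring
  rw [e] at h2
  refine h2.trans ((mul_le_mul_of_nonneg_left h1 (by positivity)).trans (le_of_eq ?_))
  field_simp
  norm_num

end Greedy

/-! ### Measurability of matrix operations -/

section Measurability

instance matrixMeasurableSpace {m n : Type*} : MeasurableSpace (Matrix m n ℝ) :=
  inferInstanceAs (MeasurableSpace (m → n → ℝ))

instance matrixBorelSpace {m n : Type*} [Finite m] [Finite n] : BorelSpace (Matrix m n ℝ) :=
  inferInstanceAs (BorelSpace (m → n → ℝ))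

instance matrixSecondCountable {m n : Type*} [Finite m] [Finite n] :
    SecondCountableTopology (Matrix m n ℝ) :=
  inferInstanceAs (SecondCountableTopology (m → n → ℝ))

instance matrixLocallyCompact {m n : Type*} [Finite m] [Finite n] :
    LocallyCompactSpace (Matrix m n ℝ) :=
  inferInstanceAs (LocallyCompactSpace (m → n → ℝ))

theorem measurable_matrix_entry {m n : Type*} (i : m) (j : n) :
    Measurable fun A : Matrix m n ℝ => A i j :=
  (measurable_pi_apply j).comp (measurable_pi_apply i)

theorem measurable_matrix_of_entries {α m n : Type*} [MeasurableSpace α] {A : α → Matrix m n ℝ}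
    (h : ∀ i j, Measurable fun x => A x i j) : Measurable A :=
  measurable_pi_iff.mpr fun i => measurable_pi_iff.mpr fun j => h i j

variable {α : Type*} [MeasurableSpace α] {l m n : Type*} [Finite l] [Fintype m] [Finite n]

theorem measurable_matrix_mul {A : α → Matrix l m ℝ} {B : α → Matrix m n ℝ} (hA : Measurable A)
    (hB : Measurable B) : Measurable fun x => A x * B x :=
  (continuous_fst.matrix_mul continuous_snd :
    Continuous fun p : Matrix l m ℝ × Matrix m n ℝ => p.1 * p.2).measurable.comp (hA.prodMk hB)

theorem measurable_matrix_sub {A B : α → Matrix l n ℝ} (hA : Measurable A)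
    (hB : Measurable B) : Measurable fun x => A x - B x :=
  (continuous_fst.sub continuous_snd :
    Continuous fun p : Matrix l n ℝ × Matrix l n ℝ => p.1 - p.2).measurable.comp (hA.prodMk hB)

theorem measurable_matrix_smul {c : α → ℝ} {B : α → Matrix l n ℝ} (hc : Measurable c)
    (hB : Measurable B) : Measurable fun x => c x • B x :=
  (continuous_fst.smul continuous_snd :
    Continuous fun p : ℝ × Matrix l n ℝ => p.1 • p.2).measurable.comp (hc.prodMk hB)

theorem measurable_matrix_transpose {A : α → Matrix l n ℝ} (hA : Measurable A) :
    Measurable fun x => (A x)ᵀ :=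
  (continuous_id.matrix_transpose : Continuous fun p : Matrix l n ℝ => pᵀ).measurable.comp hA

theorem measurable_matrix_trace {A : α → Matrix m m ℝ} (hA : Measurable A) :
    Measurable fun x => (A x).trace :=
  (continuous_id.matrix_trace : Continuous fun p : Matrix m m ℝ => p.trace).measurable.comp hA

theorem measurable_matrix_inv [DecidableEq m] {A : α → Matrix m m ℝ} (hA : Measurable A) :
    Measurable fun x => (A x)⁻¹ := by
  have : (fun x => (A x)⁻¹) = fun x => ((A x).det)⁻¹ • (A x).adjugate := by
    funext x
    rw [Matrix.inv_def, Ring.inverse_eq_inv']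
  rw [this]
  refine measurable_matrix_smul ?_ ?_
  · exact ((continuous_id.matrix_det : Continuous fun p : Matrix m m ℝ => p.det).measurable.comp
      hA).inv
  · exact (continuous_id.matrix_adjugate :
      Continuous fun p : Matrix m m ℝ => p.adjugate).measurable.comp hA

theorem measurable_matrix_mulVec {A : α → Matrix l m ℝ} {v : α → m → ℝ} (hA : Measurable A)
    (hv : Measurable v) : Measurable fun x => A x *ᵥ v x :=
  (continuous_fst.matrix_mulVec continuous_snd :
    Continuous fun p : Matrix l m ℝ × (m → ℝ) => p.1 *ᵥ p.2).measurable.comp (hA.prodMk hv)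

theorem measurable_dotProduct {u v : α → m → ℝ} (hu : Measurable u) (hv : Measurable v) :
    Measurable fun x => u x ⬝ᵥ v x :=
  (continuous_fst.dotProduct continuous_snd :
    Continuous fun p : (m → ℝ) × (m → ℝ) => p.1 ⬝ᵥ p.2).measurable.comp (hu.prodMk hv)

/-- A map with closed graph into a `σ`-compact Hausdorff space is Borel measurable. -/
theorem measurable_of_isClosed_graph {X Y : Type*} [TopologicalSpace X] [MeasurableSpace X]
    [OpensMeasurableSpace X] [TopologicalSpace Y] [SigmaCompactSpace Y] [T2Space Y]
    [MeasurableSpace Y] [BorelSpace Y] {f : X → Y}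
    (hf : IsClosed {p : X × Y | f p.1 = p.2}) : Measurable f := by
  refine measurable_of_isClosed fun C hC => ?_
  have h1 : f ⁻¹' C = ⋃ n, f ⁻¹' (C ∩ compactCovering Y n) := by
    rw [← Set.preimage_iUnion, ← Set.inter_iUnion, iUnion_compactCovering, Set.inter_univ]
  rw [h1]
  refine MeasurableSet.iUnion fun n => IsClosed.measurableSet ?_
  set K := C ∩ compactCovering Y n
  have hK : IsCompact K := (isCompact_compactCovering Y n).inter_left hC
  have : CompactSpace K := isCompact_iff_compactSpace.mp hK
  have h2 : IsClosed {p : X × K | f p.1 = p.2} :=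
    hf.preimage (continuous_fst.prodMk (continuous_subtype_val.comp continuous_snd))
  have h3 : f ⁻¹' K = Prod.fst '' {p : X × K | f p.1 = p.2} := by
    ext x
    constructor
    · intro hx
      exact ⟨(x, ⟨f x, hx⟩), rfl, rfl⟩
    · rintro ⟨⟨x', y⟩, hxy, rfl⟩
      change f x' = y at hxy
      change f x' ∈ K
      rw [hxy]; exact y.2
  rw [h3]
  exact isClosedMap_fst_of_compactSpace _ h2

/-- The pseudoinverse is discontinuous, but its graph is cut out by the four Penrose equations (by
uniqueness) and is therefore closed. -/
theorem measurable_pinv {l n : Type*} [Fintype l] [Fintype n] :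
    Measurable (pinv : Matrix l n ℝ → Matrix n l ℝ) := by
  apply measurable_of_isClosed_graph
  have : {p : Matrix l n ℝ × Matrix n l ℝ | pinv p.1 = p.2} =
      {p | p.1 * p.2 * p.1 = p.1} ∩ {p | p.2 * p.1 * p.2 = p.2} ∩
      ({p | (p.1 * p.2)ᵀ = p.1 * p.2} ∩ {p | (p.2 * p.1)ᵀ = p.2 * p.1}) := by
    ext ⟨S, X⟩
    constructor
    · intro hX
      change pinv S = X at hX
      have h := pinv_spec S
      rw [hX] at h
      exact ⟨⟨h.mul_mul_self, h.mul_mul_inv⟩, h.symm_left, h.symm_right⟩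
    · rintro ⟨⟨h1, h2⟩, h3, h4⟩
      exact (pinv_spec S).unique ⟨h1, h2, h3, h4⟩
  rw [this]
  have c1 : Continuous fun p : Matrix l n ℝ × Matrix n l ℝ => p.1 * p.2 :=
    continuous_fst.matrix_mul continuous_snd
  have c2 : Continuous fun p : Matrix l n ℝ × Matrix n l ℝ => p.2 * p.1 :=
    continuous_snd.matrix_mul continuous_fst
  exact ((isClosed_eq (c1.matrix_mul continuous_fst) continuous_fst).inter
    (isClosed_eq (c2.matrix_mul continuous_snd) continuous_snd)).inter
    ((isClosed_eq c1.matrix_transpose c1).inter (isClosed_eq c2.matrix_transpose c2))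

theorem measurable_reduction {d k : ℕ} {R : α → Matrix (Fin d) (Fin d) ℝ}
    {U : α → Matrix (Fin d) (Fin k) ℝ} (hR : Measurable R) (hU : Measurable U) :
    Measurable fun x => reduction (R x) (U x) := by
  have hUt := measurable_matrix_transpose hU
  unfold reduction
  exact measurable_matrix_mul (measurable_matrix_mul (measurable_matrix_mul
    (measurable_matrix_mul hR hU) (measurable_pinv.comp (measurable_matrix_mul
    (measurable_matrix_mul hUt hR) hU))) hUt) hR

theorem measurable_rangeProj {d k : ℕ} {U : α → Matrix (Fin d) (Fin k) ℝ} (hU : Measurable U) :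
    Measurable fun x => rangeProj (U x) := by
  have hUt := measurable_matrix_transpose hU
  unfold rangeProj
  exact measurable_matrix_mul (measurable_matrix_mul hU (measurable_matrix_inv
    (measurable_matrix_mul hUt hU))) hUt

end Measurability

/-! ### Gaussian matrices -/

section Gaussian

/-- Only null sets are transferred: it reduces almost sure full rank to a statement about Lebesgue
measure. -/
theorem pi_gaussianReal_absolutelyContinuous {ι : Type*} [Fintype ι] :
    Measure.pi (fun _ : ι => gaussianReal 0 1) ≪ volume := by
  have h1 : (1 : NNReal) ≠ 0 := one_ne_zero
  have : Measure.pi (fun _ : ι => gaussianReal 0 1) = (volume : Measure (ι → ℝ)).withDensity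
      (fun y => ENNReal.ofReal (∏ i, gaussianPDFReal 0 1 (y i))) := by
    refine Measure.pi_eq fun s hs => ?_
    rw [withDensity_apply _ (MeasurableSet.univ_pi hs), volume_pi, Measure.restrict_pi_pi,
      ← ofReal_integral_eq_lintegral_ofReal, integral_fintype_prod_eq_prod,
      ENNReal.ofReal_prod_of_nonneg]
    · exact Finset.prod_congr rfl fun i _ => (gaussianReal_apply_eq_integral 0 h1 (s i)).symm
    · exact fun i _ => integral_nonneg fun x => gaussianPDFReal_nonneg 0 1 x
    · exact Integrable.fintype_prod fun i => (integrable_gaussianPDFReal 0 1).restrict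
    · exact Filter.Eventually.of_forall fun y =>
        Finset.prod_nonneg fun i _ => gaussianPDFReal_nonneg 0 1 _
  rw [this]
  exact withDensity_absolutelyContinuous _ _

/-- A measurable set meeting every line of a fixed direction in a null set is null. -/
theorem volume_eq_zero_of_lines {ι : Type*} [Fintype ι] {N : Set (ι → ℝ)} (hN : MeasurableSet N)
    (e : ι → ℝ) (h : ∀ y, volume {t : ℝ | y + t • e ∈ N} = 0) : volume N = 0 := by
  have hS : MeasurableSet {p : (ι → ℝ) × ℝ | ¬ (p.1 + p.2 • e ∉ N)} := by
    simp only [not_not]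
    exact hN.preimage (by fun_prop)
  have h1 : ∀ᵐ y : ι → ℝ, ∀ᵐ t : ℝ, y + t • e ∉ N := by
    refine Filter.Eventually.of_forall fun y => ?_
    rw [ae_iff]
    simpa using h y
  -- Exchanging the quantifiers yields a single `t` for which the translate of `N` by `t • e` is
  -- null; translation invariance finishes.
  rw [Measure.ae_ae_comm (by simpa only [Set.compl_ofPred, not_not] using hS.compl)] at h1
  obtain ⟨t, ht⟩ := h1.exists
  rw [ae_iff] at ht
  simp only [not_not] at ht
  have := measure_preimage_add_right (volume : Measure (ι → ℝ)) (t • e) N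
  rw [← this]
  exact ht

variable {d k : ℕ}

/-- The matrix with prescribed entries. -/
def ofEntries (y : Fin d × Fin k → ℝ) : Matrix (Fin d) (Fin k) ℝ := Matrix.of fun i j => y (i, j)

theorem measurable_ofEntries : Measurable (ofEntries : (Fin d × Fin k → ℝ) → _) :=
  measurable_matrix_of_entries fun i j => measurable_pi_apply (i, j)

/-- The law of the entries of a matrix of independent standard normal variables. -/
noncomputable abbrev gaussianEntries (d k : ℕ) : Measure (Fin d × Fin k → ℝ) :=
  Measure.pi fun _ => gaussianReal 0 1

/-- Full column rank already follows from invertibility of the top `k × k` block, whose determinant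
vanishes only on a null set. -/
theorem ae_isUnit_det (hkd : k ≤ d) :
    ∀ᵐ y ∂gaussianEntries d k, IsUnit ((ofEntries y)ᵀ * ofEntries y).det := by
  set top : (Fin d × Fin k → ℝ) → Matrix (Fin k) (Fin k) ℝ :=
    fun y => Matrix.of fun i j => y (Fin.castLE hkd i, j) with htop
  have hcont : Continuous fun y => (top y).det :=
    Continuous.matrix_det (continuous_matrix fun i j => continuous_apply _)
  have hnull : volume {y | (top y).det = 0} = 0 := by
    refine volume_eq_zero_of_lines (isClosed_eq hcont continuous_const).measurableSet
      (fun p => if p.1 = Fin.castLE hkd p.2 then 1 else 0) fun y => ?_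
    -- Moving along the identity direction turns the determinant into the characteristic polynomial
    -- of minus the block, which is monic and so has finitely many roots.
    have hfin : {t : ℝ | (-(top y)).charpoly.IsRoot t}.Finite :=
      Polynomial.finite_setOfPred_isRoot (Matrix.charpoly_monic _).ne_zero
    refine measure_mono_null (fun t ht => ?_) (hfin.measure_zero _)
    simp only [Set.mem_ofPred_eq, Polynomial.IsRoot, Matrix.eval_charpoly] at ht ⊢
    rw [← ht]
    congr 1
    ext i j
    by_cases hij : i = j
    · subst hij; simp [htop, add_comm]
    · have : ¬ (Fin.castLE hkd i = Fin.castLE hkd j) := fun h => hij (by simpa using h)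
      simp [htop, hij, this, Matrix.scalar_apply]
  have h2 : ∀ᵐ y ∂gaussianEntries d k, (top y).det ≠ 0 := by
    refine pi_gaussianReal_absolutelyContinuous.ae_le ?_
    change ∀ᵐ y, (top y).det ≠ 0
    rw [ae_iff]
    simpa using hnull
  filter_upwards [h2] with y hy
  rw [← Matrix.isUnit_iff_isUnit_det]
  have hinj : Function.Injective (ofEntries y).mulVec := by
    intro v w hvw
    have h3 : top y *ᵥ v = top y *ᵥ w := by
      funext i
      exact congrFun hvw (Fin.castLE hkd i)
    exact Matrix.mulVec_injective_of_isUnit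
      ((Matrix.isUnit_iff_isUnit_det _).mpr (isUnit_iff_ne_zero.mpr hy)) h3
  simpa using (PosDef.conjTranspose_mul_self (ofEntries y) hinj).isUnit

theorem integrable_rangeProj (i j : Fin d) :
    Integrable (fun y => rangeProj (ofEntries y) i j) (gaussianEntries d k) := by
  refine Integrable.of_bound (C := 1) ?_ (Filter.Eventually.of_forall fun y => ?_)
  · exact ((measurable_matrix_entry i j).comp
      (measurable_rangeProj measurable_ofEntries)).aestronglyMeasurable
  · exact abs_rangeProj_le _ _ _

theorem measurable_rangeProj_entry (i j : Fin d) :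
    Measurable fun y : Fin d × Fin k → ℝ => rangeProj (ofEntries y) i j :=
  (measurable_matrix_entry i j).comp (measurable_rangeProj measurable_ofEntries)

theorem integral_comp_of_measurePreserving {X : Type*} [MeasurableSpace X] {γ : Measure X}
    {T : X → X} (hT : MeasurePreserving T γ γ) {g : X → ℝ} (hg : Measurable g) :
    ∫ y, g (T y) ∂γ = ∫ y, g y ∂γ := by
  rw [← integral_map hT.measurable.aemeasurable hg.aestronglyMeasurable, hT.map_eq]

/-- Flipping the sign of row `i` preserves the Gaussian law and changes the sign of the `(i, j)`
entry of the projection. -/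
theorem integral_rangeProj_offDiag {i j : Fin d} (hij : i ≠ j) :
    ∫ y, rangeProj (ofEntries y) i j ∂gaussianEntries d k = 0 := by
  set ε : Fin d → ℝ := fun l => if l = i then -1 else 1 with hε
  have hε2 : ∀ l, ε l * ε l = 1 := fun l => by by_cases h : l = i <;> simp [hε, h]
  have hpres : MeasurePreserving (fun (y : Fin d × Fin k → ℝ) p => ε p.1 * y p)
      (gaussianEntries d k) (gaussianEntries d k) := by
    have hmap : ∀ p : Fin d × Fin k, (gaussianReal 0 1).map (fun x => ε p.1 * x) =
        gaussianReal 0 1 := by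
      intro p
      rw [gaussianReal_map_const_mul, mul_zero]
      congr 1
      ext
      simp [sq, hε2]
    refine ⟨by fun_prop, ?_⟩
    have : ∀ p : Fin d × Fin k, SigmaFinite ((gaussianReal 0 1).map (fun x => ε p.1 * x)) := by
      intro p; rw [hmap]; infer_instance
    have := Measure.pi_map_pi (μ := fun _ => gaussianReal 0 1)
      (f := fun (p : Fin d × Fin k) x => ε p.1 * x) (fun p => by fun_prop)
    simpa only [hmap] using this
  have hP : ∀ y : Fin d × Fin k → ℝ, rangeProj (ofEntries fun p => ε p.1 * y p) i j =
      - rangeProj (ofEntries y) i j := by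
    intro y
    have e1 : ofEntries (fun p => ε p.1 * y p) = diagonal ε * ofEntries y := by
      ext a b; simp [ofEntries]
    have e2 : (diagonal ε * ofEntries y)ᵀ * (diagonal ε * ofEntries y) =
        (ofEntries y)ᵀ * ofEntries y := by
      rw [transpose_mul, Matrix.mul_assoc, ← Matrix.mul_assoc (diagonal ε)ᵀ, diagonal_transpose,
        diagonal_mul_diagonal]
      simp [hε2]
    have e3 : rangeProj (diagonal ε * ofEntries y) =
        diagonal ε * rangeProj (ofEntries y) * diagonal ε := by
      rw [rangeProj, e2, transpose_mul, diagonal_transpose, rangeProj]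
      simp only [Matrix.mul_assoc]
    rw [e1, e3]
    simp [hε, hij.symm]
  have h := integral_comp_of_measurePreserving hpres (measurable_rangeProj_entry (k := k) i j)
  simp only [hP, integral_neg] at h
  linarith

/-- Swapping rows `i` and `j` preserves the law and conjugates the projection by the transposition.
-/
theorem integral_rangeProj_diag_eq (i j : Fin d) :
    ∫ y, rangeProj (ofEntries y) i i ∂gaussianEntries d k =
      ∫ y, rangeProj (ofEntries y) j j ∂gaussianEntries d k := by
  set σ : Equiv.Perm (Fin d) := Equiv.swap i j with hσ
  set e : Fin d × Fin k ≃ Fin d × Fin k := Equiv.prodCongr σ (Equiv.refl _) with he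
  have hpres : MeasurePreserving (MeasurableEquiv.piCongrLeft (fun _ => ℝ) e)
      (gaussianEntries d k) (gaussianEntries d k) :=
    measurePreserving_piCongrLeft (fun _ => gaussianReal 0 1) e
  have hP : ∀ y : Fin d × Fin k → ℝ,
      rangeProj (ofEntries (MeasurableEquiv.piCongrLeft (fun _ => ℝ) e y)) j j =
        rangeProj (ofEntries y) i i := by
    intro y
    have e1 : ofEntries y =
        (ofEntries (MeasurableEquiv.piCongrLeft (fun _ => ℝ) e y)).submatrix σ id := by
      ext a b
      have := MeasurableEquiv.piCongrLeft_apply_apply (β := fun _ => ℝ) e y (a, b)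
      simpa [ofEntries, he] using this.symm
    have e2 : ∀ V : Matrix (Fin d) (Fin k) ℝ,
        rangeProj (V.submatrix σ id) = (rangeProj V).submatrix σ σ := by
      intro V
      have e3 : (V.submatrix σ id)ᵀ * V.submatrix σ id = Vᵀ * V := by
        rw [transpose_submatrix, submatrix_mul_equiv, submatrix_id_id]
      rw [rangeProj, e3, rangeProj, transpose_submatrix]
      ext a b
      simp [Matrix.mul_apply]
    rw [e1, e2]
    simp [hσ]
  have h := integral_comp_of_measurePreserving hpres (measurable_rangeProj_entry (k := k) j j)
  rw [← h]
  simp only [hP]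

/-- The `d` diagonal means are equal and add up to the almost sure trace `k`. -/
theorem integral_rangeProj_diag (hkd : k ≤ d) (i : Fin d) :
    ∫ y, rangeProj (ofEntries y) i i ∂gaussianEntries d k = (k : ℝ) / d := by
  have h1 : ∫ y, ∑ j, rangeProj (ofEntries y) j j ∂gaussianEntries d k = k := by
    rw [integral_congr_ae (g := fun _ => (k : ℝ))]
    · simp
    · filter_upwards [ae_isUnit_det hkd] with y hy
      exact trace_rangeProj hy
  rw [integral_finsetSum _ fun j _ => integrable_rangeProj j j] at h1
  simp only [fun j => integral_rangeProj_diag_eq (k := k) j i] at h1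
  have hd : (d : ℝ) ≠ 0 := by exact_mod_cast i.pos.ne'
  rw [eq_div_iff hd, mul_comm]
  simpa using h1

theorem integral_trace_rangeProj_mul (hkd : k ≤ d) (R : Matrix (Fin d) (Fin d) ℝ) :
    ∫ y, (rangeProj (ofEntries y) * R).trace ∂gaussianEntries d k = (k : ℝ) / d * R.trace := by
  have hint : ∀ i j, Integrable (fun y => rangeProj (ofEntries y) i j * R j i)
      (gaussianEntries d k) := fun i j => (integrable_rangeProj i j).mul_const _
  simp only [trace, diag_apply, Matrix.mul_apply]
  rw [integral_finsetSum _ fun i _ => integrable_finsetSum _ fun j _ => hint i j, Finset.mul_sum]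
  refine Finset.sum_congr rfl fun i _ => ?_
  rw [integral_finsetSum _ fun j _ => hint i j, Finset.sum_eq_single i]
  · rw [integral_mul_const, integral_rangeProj_diag hkd]
  · intro j _ hj
    rw [integral_mul_const, integral_rangeProj_offDiag hj.symm, zero_mul]
  · simp

/-- A Gaussian symmetric rank-`k` update reduces the trace by the factor `1 - k/d` on average. -/
theorem integral_trace_update_le (hkd : k ≤ d) {R : Matrix (Fin d) (Fin d) ℝ}
    (hR : R.PosSemidef) :
    Integrable (fun y => (R - reduction R (ofEntries y)).trace) (gaussianEntries d k) ∧
    ∫ y, (R - reduction R (ofEntries y)).trace ∂gaussianEntries d k ≤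
      (1 - (k : ℝ) / d) * R.trace := by
  have hmeas : Measurable fun y : Fin d × Fin k → ℝ => (R - reduction R (ofEntries y)).trace :=
    measurable_matrix_trace (measurable_matrix_sub measurable_const
      (measurable_reduction measurable_const measurable_ofEntries))
  have hint : Integrable (fun y => (R - reduction R (ofEntries y)).trace)
      (gaussianEntries d k) := by
    refine Integrable.of_bound (C := R.trace) hmeas.aestronglyMeasurable
      (Filter.Eventually.of_forall fun y => ?_)
    obtain ⟨h1, h2⟩ := reduction_posSemidef hR (ofEntries y)
    rw [Real.norm_of_nonneg h2.trace_nonneg, trace_sub]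
    linarith [h1.trace_nonneg]
  have hint2 : Integrable (fun y => (rangeProj (ofEntries y) * R).trace)
      (gaussianEntries d k) := by
    simp only [trace, diag_apply, Matrix.mul_apply]
    exact integrable_finsetSum _ fun i _ => integrable_finsetSum _ fun j _ =>
      (integrable_rangeProj i j).mul_const _
  refine ⟨hint, ?_⟩
  calc ∫ y, (R - reduction R (ofEntries y)).trace ∂gaussianEntries d k
      ≤ ∫ y, (R.trace - (rangeProj (ofEntries y) * R).trace) ∂gaussianEntries d k := by
        refine integral_mono hint ((integrable_const _).sub hint2) fun y => ?_
        have := trace_rangeProj_mul_le_trace_reduction hR (ofEntries y)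
        simp only [trace_sub]
        linarith
    _ = (1 - (k : ℝ) / d) * R.trace := by
        rw [integral_sub (integrable_const _) hint2, integral_trace_rangeProj_mul hkd]
        simp; ring

end Gaussian

/-! ### The randomized strategy -/

section Randomized

variable {d k : ℕ} {L μ M η₀ : ℝ} {f : EuclideanSpace ℝ (Fin d) → ℝ}
  {x₀ : EuclideanSpace ℝ (Fin d)} {G₀ : Matrix (Fin d) (Fin d) ℝ}

/-- Derivatives are Borel measurable without any regularity of the Hessian. -/
theorem measurable_hess : Measurable (hess f) := by
  refine measurable_matrix_of_entries fun i j => ?_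
  have h1 : Measurable fun x => fderiv ℝ (gradient f) x (EuclideanSpace.single j 1) :=
    measurable_fderiv_apply_const ℝ _ _
  exact (measurable_pi_apply i).comp ((WithLp.measurable_ofLp 2 _).comp h1)

theorem measurable_gradient (hf : TwiceDifferentiable f) :
    Measurable fun x => (gradient f x).ofLp :=
  (WithLp.measurable_ofLp 2 _).comp hf.2.continuous.measurable

theorem measurable_wnorm {α : Type*} [MeasurableSpace α] {A : α → Matrix (Fin d) (Fin d) ℝ}
    {v : α → EuclideanSpace ℝ (Fin d)} (hA : Measurable A) (hv : Measurable v) :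
    Measurable fun x => wnorm (A x) (v x) := by
  have hv' : Measurable fun x => (v x).ofLp := (WithLp.measurable_ofLp 2 _).comp hv
  exact (measurable_dotProduct hv' (measurable_matrix_mulVec hA hv')).sqrt

theorem measurable_lam (hf : TwiceDifferentiable f) : Measurable (lam f) :=
  measurable_wnorm (measurable_matrix_inv measurable_hess) hf.2.continuous.measurable

theorem measurable_nextPoint (hf : TwiceDifferentiable f) :
    Measurable fun z : EuclideanSpace ℝ (Fin d) × Matrix (Fin d) (Fin d) ℝ =>
      nextPoint f z.1 z.2 :=
  measurable_fst.sub ((WithLp.measurable_toLp 2 _).comp (measurable_matrix_mulVec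
    (measurable_matrix_inv measurable_snd) ((measurable_gradient hf).comp measurable_fst)))

theorem measurable_corrected (hf : TwiceDifferentiable f) :
    Measurable fun z : EuclideanSpace ℝ (Fin d) × Matrix (Fin d) (Fin d) ℝ =>
      corrected f M z.1 z.2 :=
  measurable_matrix_smul (((measurable_wnorm (measurable_hess.comp measurable_fst)
    ((measurable_nextPoint hf).sub measurable_fst)).const_mul M).const_add 1) measurable_snd

theorem measurable_step (hf : TwiceDifferentiable f) :
    Measurable fun p : (EuclideanSpace ℝ (Fin d) × Matrix (Fin d) (Fin d) ℝ) ×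
      Matrix (Fin d) (Fin k) ℝ => step f M p.1 p.2 := by
  have h1 : Measurable fun p : (EuclideanSpace ℝ (Fin d) × Matrix (Fin d) (Fin d) ℝ) ×
      Matrix (Fin d) (Fin k) ℝ => nextPoint f p.1.1 p.1.2 :=
    (measurable_nextPoint hf).comp measurable_fst
  have h2 : Measurable fun p : (EuclideanSpace ℝ (Fin d) × Matrix (Fin d) (Fin d) ℝ) ×
      Matrix (Fin d) (Fin k) ℝ => corrected f M p.1.1 p.1.2 :=
    (measurable_corrected hf).comp measurable_fst
  have h3 := (measurable_hess (f := f)).comp h1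
  exact h1.prodMk (measurable_matrix_sub h2
    (measurable_reduction (measurable_matrix_sub h2 h3) measurable_snd))

theorem measurable_statePotential (hf : TwiceDifferentiable f) :
    Measurable (statePotential k L μ M η₀ f) := by
  have h1 : Measurable fun z : EuclideanSpace ℝ (Fin d) × Matrix (Fin d) (Fin d) ℝ =>
      M * lam f z.1 := ((measurable_lam hf).comp measurable_fst).const_mul M
  have h2 : Measurable (gap f μ) := (measurable_matrix_trace (measurable_matrix_sub measurable_snd
    (measurable_hess.comp measurable_fst))).div_const μ
  unfold statePotential potential
  fun_prop

/-- The indices of the entries used before iteration `t`. -/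
def pastIndices (d k t : ℕ) : Finset (ℕ × Fin d × Fin k) := Finset.range t ×ˢ Finset.univ

/-- The sequence of matrices with the given entries before iteration `t` and zero afterwards. -/
noncomputable def ofPast {t : ℕ} (w : pastIndices d k t → ℝ) (s : ℕ) : Matrix (Fin d) (Fin k) ℝ :=
  Matrix.of fun i j => if h : (s, i, j) ∈ pastIndices d k t then w ⟨(s, i, j), h⟩ else 0

theorem measurable_ofPast (t s : ℕ) :
    Measurable fun w : pastIndices d k t → ℝ => ofPast w s := by
  refine measurable_matrix_of_entries fun i j => ?_
  by_cases h : (s, i, j) ∈ pastIndices d k t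
  · simpa [ofPast, h] using measurable_pi_apply _
  · simp [ofPast, h]

theorem run_congr {U V : ℕ → Matrix (Fin d) (Fin k) ℝ} {t : ℕ} (h : ∀ s < t, U s = V s) :
    run f M x₀ G₀ U t = run f M x₀ G₀ V t := by
  induction t with
  | zero => rfl
  | succ t ih =>
    rw [run_succ, run_succ, ih fun s hs => h s (by omega), h t (by omega)]

/-- The entries used before iteration `t`. -/
def pastEntries {Ω : Type*} (U : Ω → ℕ → Matrix (Fin d) (Fin k) ℝ) (t : ℕ) (ω : Ω)
    (p : pastIndices d k t) : ℝ :=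
  U ω p.1.1 p.1.2.1 p.1.2.2

theorem run_ofPast {Ω : Type*} (U : Ω → ℕ → Matrix (Fin d) (Fin k) ℝ) (t : ℕ) (ω : Ω) :
    run f M x₀ G₀ (ofPast (pastEntries U t ω)) t = run f M x₀ G₀ (U ω) t := by
  refine run_congr fun s hs => ?_
  ext i j
  have : (s, i, j) ∈ pastIndices d k t := by simp [pastIndices, hs]
  simp [ofPast, pastEntries, this]

theorem measurable_run_ofPast (hf : TwiceDifferentiable f) (t s : ℕ) :
    Measurable fun w : pastIndices d k t → ℝ => run f M x₀ G₀ (ofPast w) s := by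
  induction s with
  | zero => exact measurable_const
  | succ s ih => exact (measurable_step hf).comp (ih.prodMk (measurable_ofPast t s))

section

variable {Ω : Type*} [MeasurableSpace Ω] {P : Measure Ω}
  {U : Ω → ℕ → Matrix (Fin d) (Fin k) ℝ}

theorem IsRandomized.aemeasurable_pastEntries (hU : IsRandomized P U) (t : ℕ) :
    AEMeasurable (pastEntries U t) P :=
  aemeasurable_pi_lambda _ fun p => (hU.1 p.1.1 p.1.2.1 p.1.2.2).aemeasurable

theorem IsRandomized.aemeasurable_run (hf : TwiceDifferentiable f) (hU : IsRandomized P U)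
    (t : ℕ) : AEMeasurable (fun ω => run f M x₀ G₀ (U ω) t) P := by
  have := (measurable_run_ofPast (M := M) (x₀ := x₀) (G₀ := G₀) hf t t).comp_aemeasurable
    (hU.aemeasurable_pastEntries t)
  simpa only [Function.comp_def, run_ofPast] using this

/-- The entries of `U t`. -/
def entries (U : Ω → ℕ → Matrix (Fin d) (Fin k) ℝ) (t : ℕ) (ω : Ω) (p : Fin d × Fin k) : ℝ :=
  U ω t p.1 p.2

theorem IsRandomized.aemeasurable_entries (hU : IsRandomized P U) (t : ℕ) :
    AEMeasurable (entries U t) P :=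
  aemeasurable_pi_lambda _ fun p => (hU.1 t p.1 p.2).aemeasurable

/-- Past and present entries belong to disjoint finite index sets; this independence is what
justifies conditioning on the current state. -/
theorem IsRandomized.indepFun_past (hU : IsRandomized P U) (t : ℕ) :
    IndepFun (pastEntries U t) (entries U t) P := by
  have hdisj : Disjoint (pastIndices d k t) ({t} ×ˢ Finset.univ) := by
    rw [Finset.disjoint_left]
    rintro ⟨s, i, j⟩ h1 h2
    simp [pastIndices] at h1 h2
    omega
  have h1 := hU.2.indepFun_finset₀ _ _ hdisj fun p => (hU.1 p.1 p.2.1 p.2.2).aemeasurable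
  have hφ : Measurable fun (w : ({t} ×ˢ Finset.univ : Finset (ℕ × Fin d × Fin k)) → ℝ)
      (p : Fin d × Fin k) => w ⟨(t, p.1, p.2), by simp⟩ :=
    measurable_pi_lambda _ fun p => measurable_pi_apply _
  exact h1.comp measurable_id hφ

theorem Start.aemeasurable_ratio (h : Start k L μ M η₀ f x₀ G₀) (hU : IsRandomized P U) (t : ℕ) :
    AEMeasurable (fun ω => ratio f M x₀ G₀ (U ω) t) P := by
  have hl : ∀ t, AEMeasurable (fun ω => lamAt f M x₀ G₀ (U ω) t) P := fun t =>
    ((measurable_lam h.objective.twiceDiff).comp measurable_fst).comp_aemeasurable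
      (hU.aemeasurable_run h.objective.twiceDiff t)
  exact (hl (t + 1)).div (hl t)

variable [IsProbabilityMeasure P]

theorem IsRandomized.map_entries (hU : IsRandomized P U) (t : ℕ) :
    P.map (entries U t) = gaussianEntries d k := by
  have hinj : Function.Injective fun p : Fin d × Fin k => (t, p.1, p.2) := by
    intro p q h
    simpa [Prod.ext_iff] using h
  have h1 := hU.2.precomp hinj
  have h2 := (iIndepFun_iff_map_fun_eq_pi_map
    (fun p : Fin d × Fin k => (hU.1 t p.1 p.2).aemeasurable)).mp h1
  have h3 : (fun p : Fin d × Fin k => P.map fun ω => U ω t p.1 p.2) =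
      fun _ => gaussianReal 0 1 := funext fun p => (hU.1 t p.1 p.2).map_eq
  exact h2.trans (congrArg Measure.pi h3)

/-- Conditioning on the state before iteration `t`: the directions of that iteration may be
integrated out first. -/
theorem IsRandomized.lintegral_run (hf : TwiceDifferentiable f) (hU : IsRandomized P U) (t : ℕ)
    {g : (EuclideanSpace ℝ (Fin d) × Matrix (Fin d) (Fin d) ℝ) × Matrix (Fin d) (Fin k) ℝ →
      ENNReal} (hg : Measurable g) :
    ∫⁻ ω, g (run f M x₀ G₀ (U ω) t, U ω t) ∂P =
      ∫⁻ ω, ∫⁻ y, g (run f M x₀ G₀ (U ω) t, ofEntries y) ∂gaussianEntries d k ∂P := by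
  have hX := hU.aemeasurable_pastEntries t
  have hY := hU.aemeasurable_entries t
  have hr := measurable_run_ofPast (M := M) (x₀ := x₀) (G₀ := G₀) (k := k) hf t t
  set g' : (pastIndices d k t → ℝ) × (Fin d × Fin k → ℝ) → ENNReal :=
    fun p => g (run f M x₀ G₀ (ofPast p.1) t, ofEntries p.2) with hg'
  have hg'm : Measurable g' :=
    hg.comp ((hr.comp measurable_fst).prodMk (measurable_ofEntries.comp measurable_snd))
  have hlaw := (indepFun_iff_map_prod_eq_prod_map_map hX hY).mp (hU.indepFun_past t)
  calc ∫⁻ ω, g (run f M x₀ G₀ (U ω) t, U ω t) ∂P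
      = ∫⁻ ω, g' (pastEntries U t ω, entries U t ω) ∂P := by
        refine lintegral_congr fun ω => ?_
        simp only [hg', run_ofPast]
        rfl
    _ = ∫⁻ p, g' p ∂((P.map (pastEntries U t)).prod (gaussianEntries d k)) := by
        rw [← hU.map_entries t, ← hlaw, lintegral_map' hg'm.aemeasurable (hX.prodMk hY)]
    _ = ∫⁻ w, ∫⁻ y, g' (w, y) ∂gaussianEntries d k ∂(P.map (pastEntries U t)) :=
        lintegral_prod _ hg'm.aemeasurable
    _ = ∫⁻ ω, ∫⁻ y, g' (pastEntries U t ω, y) ∂gaussianEntries d k ∂P :=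
        lintegral_map' hg'm.lintegral_prod_right'.aemeasurable hX
    _ = _ := by simp only [hg', run_ofPast]

/-- The new point does not depend on the fresh directions, so the new potential is affine in the new
gap, and averaging merely replaces the gap by its mean. -/
theorem Start.lintegral_step_le (h : Start k L μ M η₀ f x₀ G₀)
    {z : EuclideanSpace ℝ (Fin d) × Matrix (Fin d) (Fin d) ℝ} (hz : Loewner (hess f z.1) z.2)
    (ha : M * lam f z.1 ≤ M * lam f x₀) :
    ∫⁻ y, ENNReal.ofReal (statePotential k L μ M η₀ f (step f M z (ofEntries y)))
        ∂gaussianEntries d k ≤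
      ENNReal.ofReal ((1 - (k : ℝ) / d + d * (L / μ) * (M * lam f z.1)) *
        statePotential k L μ M η₀ f z) := by
  obtain ⟨hint, hle⟩ := integral_trace_update_le (k := k) h.k_lt_d.le
    (h.objective.residual_posSemidef hz)
  set K := d * (L / μ) with hK
  set e := weight K (1 - (k : ℝ) / d) η₀ with he
  set a := M * lam f (nextPoint f z.1 z.2) with ha'
  set T : (Fin d × Fin k → ℝ) → ℝ := fun y =>
    (residual f M z.1 z.2 - reduction (residual f M z.1 z.2) (ofEntries y)).trace with hT
  have hSP : ∀ y, statePotential k L μ M η₀ f (step f M z (ofEntries y)) =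
      T y / μ * (1 + e * a) + 2 * K * a := by
    intro y
    have h1 : gap f μ (step f M z (ofEntries y)) = T y / μ := by rw [gap, step_snd_sub]
    have h2 : (step f M z (ofEntries y)).1 = nextPoint f z.1 z.2 := rfl
    rw [statePotential, h1, h2, potential, ← hK, ← he, ← ha']
    ring
  have hint2 : Integrable (fun y => T y / μ * (1 + e * a) + 2 * K * a) (gaussianEntries d k) :=
    ((hint.div_const μ).mul_const _).add (integrable_const _)
  have hnn : ∀ y, 0 ≤ T y / μ * (1 + e * a) + 2 * K * a := fun y => by
    rw [← hSP]; exact h.statePotential_nonneg (h.objective.step_lower hz _)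
  simp only [hSP]
  rw [← ofReal_integral_eq_lintegral_ofReal hint2 (Filter.Eventually.of_forall hnn)]
  refine ENNReal.ofReal_le_ofReal ?_
  have hval : ∫ y, (T y / μ * (1 + e * a) + 2 * K * a) ∂gaussianEntries d k =
      potential K e a ((∫ y, T y ∂gaussianEntries d k) / μ) := by
    rw [integral_add ((hint.div_const μ).mul_const _) (integrable_const _), integral_mul_const,
      integral_div, potential]
    simp; ring
  rw [hval]
  refine h.potential_le hz ha ?_
  rw [← mul_div_assoc]
  exact div_le_div_of_nonneg_right hle h.objective.mu_pos.le

/-- The random factor `ρ + K a_t` has a deterministic bound valid for all directions, so it leaves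
the expectation and the greedy induction carries over. Lower integrals spare a proof that the
potential is integrable. -/
theorem Start.lintegral_potential_le (h : Start k L μ M η₀ f x₀ G₀) (hU : IsRandomized P U)
    (t : ℕ) :
    ∫⁻ ω, ENNReal.ofReal (statePotential k L μ M η₀ f (run f M x₀ G₀ (U ω) t)) ∂P ≤
      ENNReal.ofReal (potentialBound (d * (L / μ)) (1 - (k : ℝ) / d) η₀ (M * lam f x₀) t) := by
  have r := h.rates
  have hf := h.objective.twiceDiff
  induction t with
  | zero =>
    have := ENNReal.ofReal_le_ofReal h.statePotential_zero
    simpa [run] using this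
  | succ t ih =>
    set a := M * lam f x₀ * (1 - 1 / (2 * η₀)) ^ t with ha
    have ha0 : 0 ≤ a := mul_nonneg r.nonneg (pow_nonneg (beta_bounds h.one_le_eta).1 t)
    have hc : 0 ≤ 1 - (k : ℝ) / d + d * (L / μ) * a := by
      have := r.rho_pos; have := r.two_le
      positivity
    calc ∫⁻ ω, ENNReal.ofReal (statePotential k L μ M η₀ f (run f M x₀ G₀ (U ω) (t + 1))) ∂P
        = ∫⁻ ω, ∫⁻ y, ENNReal.ofReal (statePotential k L μ M η₀ f
            (step f M (run f M x₀ G₀ (U ω) t) (ofEntries y))) ∂gaussianEntries d k ∂P :=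
          hU.lintegral_run hf t (g := fun p => ENNReal.ofReal
            (statePotential k L μ M η₀ f (step f M p.1 p.2)))
            ((measurable_statePotential hf).comp (measurable_step hf)).ennreal_ofReal
      _ ≤ ∫⁻ ω, ENNReal.ofReal (1 - (k : ℝ) / d + d * (L / μ) * a) *
            ENNReal.ofReal (statePotential k L μ M η₀ f (run f M x₀ G₀ (U ω) t)) ∂P := by
          refine lintegral_mono fun ω => ?_
          have hz := h.loewner_run (U ω) t
          refine (h.lintegral_step_le hz (h.mul_lamAt_le_init (U ω) t)).trans ?_
          rw [← ENNReal.ofReal_mul hc]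
          refine ENNReal.ofReal_le_ofReal (mul_le_mul_of_nonneg_right ?_
            (h.statePotential_nonneg hz))
          have := mul_le_mul_of_nonneg_left (h.mul_lamAt_le (U ω) t)
            (by linarith [r.two_le] : 0 ≤ d * (L / μ))
          rw [lamAt] at this
          linarith
      _ = ENNReal.ofReal (1 - (k : ℝ) / d + d * (L / μ) * a) *
            ∫⁻ ω, ENNReal.ofReal (statePotential k L μ M η₀ f (run f M x₀ G₀ (U ω) t)) ∂P :=
          lintegral_const_mul'' _ ((measurable_statePotential hf).comp_aemeasurable
            (hU.aemeasurable_run hf t)).ennreal_ofReal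
      _ ≤ ENNReal.ofReal (1 - (k : ℝ) / d + d * (L / μ) * a) * ENNReal.ofReal
            (potentialBound (d * (L / μ)) (1 - (k : ℝ) / d) η₀ (M * lam f x₀) t) := by gcongr
      _ ≤ _ := by
          rw [← ENNReal.ofReal_mul hc]
          exact ENNReal.ofReal_le_ofReal (r.mul_potentialBound_le le_rfl)

theorem Start.lintegral_ratio_le (h : Start k L μ M η₀ f x₀ G₀) (hU : IsRandomized P U) (t : ℕ) :
    ∫⁻ ω, ENNReal.ofReal (ratio f M x₀ G₀ (U ω) t) ∂P ≤
      ENNReal.ofReal (2 * d * (L / μ) * η₀ * (1 - (k : ℝ) / d) ^ t) := by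
  calc _ ≤ ∫⁻ ω, ENNReal.ofReal (statePotential k L μ M η₀ f (run f M x₀ G₀ (U ω) t)) ∂P :=
        lintegral_mono fun ω => ENNReal.ofReal_le_ofReal (h.ratio_le_potential (U ω) t)
    _ ≤ _ := h.lintegral_potential_le hU t
    _ ≤ _ := by
        refine ENNReal.ofReal_le_ofReal ((h.rates.potentialBound_le t).trans (le_of_eq ?_))
        ring

theorem Start.integrable_ratio (h : Start k L μ M η₀ f x₀ G₀) (hU : IsRandomized P U) (t : ℕ) :
    Integrable (fun ω => ratio f M x₀ G₀ (U ω) t) P := by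
  refine Integrable.of_bound (C := 1) (h.aemeasurable_ratio hU t).aestronglyMeasurable
    (Filter.Eventually.of_forall fun ω => ?_)
  rw [Real.norm_of_nonneg (ratio_nonneg _ _)]
  exact h.ratio_le_one _ _

theorem Start.integral_ratio_le (h : Start k L μ M η₀ f x₀ G₀) (hU : IsRandomized P U) (t : ℕ) :
    ∫ ω, ratio f M x₀ G₀ (U ω) t ∂P ≤ 2 * d * (L / μ) * η₀ * (1 - (k : ℝ) / d) ^ t := by
  have r := h.rates
  have hb : 0 ≤ 2 * d * (L / μ) * η₀ * (1 - (k : ℝ) / d) ^ t := by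
    have h1 := r.rho_pos; have h2 := r.two_le; have h3 := r.one_le_eta
    have : 0 ≤ 2 * (d * (L / μ)) * η₀ * (1 - (k : ℝ) / d) ^ t := by positivity
    linarith
  rw [integral_eq_lintegral_of_nonneg_ae (Filter.Eventually.of_forall fun ω => ratio_nonneg _ _)
    (h.aemeasurable_ratio hU t).aestronglyMeasurable]
  exact ENNReal.toReal_le_of_le_ofReal hb (h.lintegral_ratio_le hU t)

/-- Markov's inequality for one contraction factor. -/
theorem Start.measure_ratio_gt_le (h : Start k L μ M η₀ f x₀ G₀) (hU : IsRandomized P U)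
    (t₀ t : ℕ) :
    P {ω | (1 - (k : ℝ) / (d + k)) ^ t * (1 / 2) < ratio f M x₀ G₀ (U ω) (t₀ + t)} ≤
      ENNReal.ofReal (4 * (d * (L / μ)) * η₀ * (1 - (k : ℝ) / d) ^ t₀ *
        (1 - ((k : ℝ) / d) ^ 2) ^ t) := by
  have hk : (0 : ℝ) < k := by exact_mod_cast h.one_le_k
  have hd : (0 : ℝ) < d := by exact_mod_cast h.objective.dim_pos
  have hcd : 1 - (k : ℝ) / (d + k) = d / (d + k) := by field_simp; ring
  have hc : 0 < 1 - (k : ℝ) / (d + k) := by rw [hcd]; positivity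
  set c := (1 - (k : ℝ) / (d + k)) ^ t * (1 / 2) with hcdef
  have hc0 : 0 < c := by positivity
  have h1 := mul_meas_ge_le_lintegral₀ (h.aemeasurable_ratio hU (t₀ + t)).ennreal_ofReal
    (ENNReal.ofReal c)
  have h2 := h1.trans (h.lintegral_ratio_le hU (t₀ + t))
  have h3 : P {ω | c < ratio f M x₀ G₀ (U ω) (t₀ + t)} ≤
      P {ω | ENNReal.ofReal c ≤ ENNReal.ofReal (ratio f M x₀ G₀ (U ω) (t₀ + t))} :=
    measure_mono fun ω hω => ENNReal.ofReal_le_ofReal (le_of_lt hω)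
  refine h3.trans ?_
  rw [mul_comm, ← ENNReal.le_div_iff_mul_le (Or.inl (ENNReal.ofReal_pos.mpr hc0).ne')
    (Or.inl ENNReal.ofReal_ne_top), ← ENNReal.ofReal_div_of_pos hc0] at h2
  refine h2.trans (ENNReal.ofReal_le_ofReal (le_of_eq ?_))
  rw [div_eq_iff hc0.ne', hcdef]
  -- Since `1 - k/(d+k) = d/(d+k)`, dividing `ρ` by it leaves `(d-k)(d+k)/d²`. The slightly weaker
  -- rate is what makes the failure probabilities summable over `t`.
  have e : 1 - (k : ℝ) / d = (1 - ((k : ℝ) / d) ^ 2) * (1 - (k : ℝ) / (d + k)) := by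
    rw [hcd]; field_simp; ring
  have e2 : (1 - (k : ℝ) / d) ^ t = (1 - ((k : ℝ) / d) ^ 2) ^ t * (1 - (k : ℝ) / (d + k)) ^ t := by
    rw [← mul_pow, ← e]
  rw [pow_add, e2]
  ring

/-- Failure forces some ratio above its threshold. The union bound sums to `4 K η₀ ρ^{t₀} (d/k)²`,
and `(d/k)² ≤ K²`. -/
theorem Start.randomized_lamAt_le (h : Start k L μ M η₀ f x₀ G₀) (hU : IsRandomized P U) {δ : ℝ}
    (hδ : 0 < δ) (hδ1 : δ < 1) {t₀ : ℕ}
    (ht₀ : 5 * (d * Real.log (L / μ * d * η₀ / δ) / k) ≤ t₀) :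
    ENNReal.ofReal (1 - δ) ≤ P {ω | ∀ t : ℕ, lamAt f M x₀ G₀ (U ω) (t₀ + t) ≤
      (1 - (k : ℝ) / (d + k)) ^ (t * (t - 1) / 2) * (1 / 2 : ℝ) ^ t *
        (1 - 1 / (2 * η₀)) ^ t₀ * lam f x₀} := by
  have r := h.rates
  have hk1 : (1 : ℝ) ≤ k := by exact_mod_cast h.one_le_k
  have hkd : (k : ℝ) < d := by exact_mod_cast h.k_lt_d
  have hd : (0 : ℝ) < d := by linarith
  have hK2 := r.two_le
  have hη := r.one_le_eta
  have hρ := r.rho_pos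
  have hκ : 1 ≤ L / μ := (one_le_div h.objective.mu_pos).mpr h.objective.mu_le_L
  have hdK : (d : ℝ) ≤ d * (L / μ) := le_mul_of_one_le_right hd.le hκ
  obtain ⟨K, hK⟩ : ∃ K, K = d * (L / μ) := ⟨_, rfl⟩
  rw [← hK] at hK2 hdK
  set A := {ω | ∀ t : ℕ, lamAt f M x₀ G₀ (U ω) (t₀ + t) ≤
      (1 - (k : ℝ) / (d + k)) ^ (t * (t - 1) / 2) * (1 / 2 : ℝ) ^ t *
        (1 - 1 / (2 * η₀)) ^ t₀ * lam f x₀} with hA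
  have hc0 : 0 ≤ 1 - (k : ℝ) / (d + k) := by
    rw [sub_nonneg, div_le_one (by linarith)]; linarith
  have hsub : Aᶜ ⊆ ⋃ t, {ω | (1 - (k : ℝ) / (d + k)) ^ t * (1 / 2) <
      ratio f M x₀ G₀ (U ω) (t₀ + t)} := by
    intro ω hω
    by_contra hcon
    refine hω (h.lamAt_le_of_ratio_le (U ω) hc0 t₀ fun t => ?_)
    by_contra hlt
    exact hcon (Set.mem_iUnion.mpr ⟨t, not_le.mp hlt⟩)
  set q := 1 - ((k : ℝ) / d) ^ 2 with hq
  have hkd1 : (k : ℝ) / d < 1 := (div_lt_one hd).mpr hkd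
  have hkd0 : 0 < (k : ℝ) / d := by positivity
  have hq0 : 0 ≤ q := by rw [hq]; nlinarith
  have hq1 : q < 1 := by rw [hq]; nlinarith [sq_pos_of_pos hkd0]
  set D := 4 * K * η₀ * (1 - (k : ℝ) / d) ^ t₀ with hD
  have hD0 : 0 ≤ D := by positivity
  have hDδ : D * (1 - q)⁻¹ ≤ δ := by
    obtain ⟨B, hB⟩ : ∃ B, B = L / μ * d * η₀ / δ := ⟨_, rfl⟩
    have hBK : B * δ = K * η₀ := by rw [hB, hK]; field_simp
    have hKB : K ≤ B := by
      rw [hB, le_div_iff₀ hδ]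
      have : L / μ * d * η₀ = K * η₀ := by rw [hK]; ring
      rw [this]; nlinarith
    have hB2 : 2 ≤ B := hK2.trans hKB
    -- Since `K η₀ = B δ`, this makes the union bound at most `δ`. The constant `5` comes from `4 K²
    -- B ≤ B^5`, using `K ≤ B` and `4 ≤ B²`.
    have h1 : (1 - (k : ℝ) / d) ^ t₀ ≤ (4 * K ^ 2 * B)⁻¹ := by
      refine h.rho_pow_le (by positivity) (le_trans ?_ ht₀)
      rw [inv_inv, ← hB, mul_div_assoc', mul_left_comm]
      refine div_le_div_of_nonneg_right (mul_le_mul_of_nonneg_left ?_ hd.le) (by linarith)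
      have : (5 : ℝ) * Real.log B = Real.log (B ^ 5) := by rw [Real.log_pow]; norm_num
      rw [this]
      refine Real.log_le_log (by positivity) ?_
      have e1 : K ^ 2 ≤ B ^ 2 := pow_le_pow_left₀ (by linarith) hKB 2
      have e2 : (4 : ℝ) ≤ B ^ 2 := by nlinarith
      calc 4 * K ^ 2 * B ≤ B ^ 2 * B ^ 2 * B := by gcongr
        _ = B ^ 5 := by ring
    have h2 : (1 - q)⁻¹ ≤ K ^ 2 := by
      have e1 : (1 - q)⁻¹ = (d / k) ^ 2 := by rw [hq, sub_sub_cancel, ← inv_pow, inv_div]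
      rw [e1]
      refine pow_le_pow_left₀ (by positivity) ((div_le_self hd.le hk1).trans hdK) 2
    calc D * (1 - q)⁻¹ ≤ (4 * K * η₀ * (4 * K ^ 2 * B)⁻¹) * K ^ 2 := by
          have : 0 ≤ (1 - q)⁻¹ := inv_nonneg.mpr (by linarith)
          rw [hD]
          gcongr
      _ = δ * (B * (4 * K ^ 2)) * (4 * K ^ 2 * B)⁻¹ := by
          linear_combination (-4 * K ^ 2 * (4 * K ^ 2 * B)⁻¹) * hBK
      _ = δ := by field_simp
  have hcompl : P Aᶜ ≤ ENNReal.ofReal δ := by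
    calc P Aᶜ ≤ ∑' t, P {ω | (1 - (k : ℝ) / (d + k)) ^ t * (1 / 2) <
          ratio f M x₀ G₀ (U ω) (t₀ + t)} := (measure_mono hsub).trans (measure_iUnion_le _)
      _ ≤ ∑' t, ENNReal.ofReal (D * q ^ t) := ENNReal.tsum_le_tsum fun t => by
          rw [hD, hK]; exact h.measure_ratio_gt_le hU t₀ t
      _ = ENNReal.ofReal (∑' t, D * q ^ t) :=
          (ENNReal.ofReal_tsum_of_nonneg (fun t => by positivity)
            ((summable_geometric_of_lt_one hq0 hq1).mul_left D)).symm
      _ ≤ ENNReal.ofReal δ := by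
          refine ENNReal.ofReal_le_ofReal ?_
          rw [tsum_mul_left, tsum_geometric_of_lt_one hq0 hq1]
          exact hDδ
  -- Subadditivity alone is used, so measurability of the event `A` is not needed.
  have huniv : 1 ≤ P A + P Aᶜ := by
    rw [← measure_univ (μ := P), ← Set.union_compl_self A]
    exact measure_union_le A Aᶜ
  rw [ENNReal.ofReal_sub _ hδ.le, ENNReal.ofReal_one]
  exact tsub_le_iff_right.mpr (huniv.trans (by gcongr))

end

end Randomized

end SRk

theorem theorem4p3 :
    ∃ C : ℝ, 0 < C ∧
      ∀ (d k : ℕ) (L μ M η₀ : ℝ) (f : EuclideanSpace ℝ (Fin d) → ℝ)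
        (x₀ : EuclideanSpace ℝ (Fin d)) (G₀ : Matrix (Fin d) (Fin d) ℝ),
        1 ≤ k → k < d → 0 < μ → 0 ≤ M → 1 ≤ η₀ →
        SRk.TwiceDifferentiable f →
        SRk.LSmooth L f →
        StrongConvexOn Set.univ μ f →
        SRk.StronglySelfConcordant M f →
        M * SRk.lam f x₀ ≤
          Real.log 2 / 2 * (((d : ℝ) - k) / (η₀ * (d : ℝ) ^ 2 * (L / μ))) →
        SRk.Loewner (SRk.hess f x₀) G₀ →
        SRk.Loewner G₀ (η₀ • SRk.hess f x₀) →
        -- randomized strategy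
        (∀ {Ω : Type*} [MeasurableSpace Ω] (P : MeasureTheory.Measure Ω)
          [MeasureTheory.IsProbabilityMeasure P] (U : Ω → ℕ → Matrix (Fin d) (Fin k) ℝ),
          SRk.IsRandomized P U →
          (∀ t : ℕ,
            MeasureTheory.Integrable (fun ω =>
              SRk.lamAt f M x₀ G₀ (U ω) (t + 1) / SRk.lamAt f M x₀ G₀ (U ω) t) P ∧
            ∫ ω, SRk.lamAt f M x₀ G₀ (U ω) (t + 1) / SRk.lamAt f M x₀ G₀ (U ω) t ∂P
              ≤ 2 * d * (L / μ) * η₀ * (1 - (k : ℝ) / d) ^ t) ∧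
          (∀ δ : ℝ, 0 < δ → δ < 1 → ∀ t₀ : ℕ,
            t₀ = ⌈C * (d * Real.log (L / μ * d * η₀ / δ) / k)⌉₊ →
            ENNReal.ofReal (1 - δ) ≤ P {ω | ∀ t : ℕ,
              SRk.lamAt f M x₀ G₀ (U ω) (t₀ + t) ≤
                (1 - (k : ℝ) / (d + k)) ^ (t * (t - 1) / 2) * (1 / 2 : ℝ) ^ t
                  * (1 - 1 / (2 * η₀)) ^ t₀ * SRk.lam f x₀})) ∧
        -- greedy strategy
        (∀ U : ℕ → Matrix (Fin d) (Fin k) ℝ, SRk.IsGreedy f M x₀ G₀ U →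
          (∀ t : ℕ,
            SRk.lamAt f M x₀ G₀ U (t + 1) / SRk.lamAt f M x₀ G₀ U t
              ≤ 2 * d * (L / μ) * η₀ * (1 - (k : ℝ) / d) ^ t) ∧
          (∀ t₀ : ℕ, t₀ = ⌈C * (d * Real.log (η₀ * d * (L / μ)) / k)⌉₊ →
            ∀ t : ℕ,
              SRk.lamAt f M x₀ G₀ U (t₀ + t) ≤
                (1 - (k : ℝ) / d) ^ (t * (t - 1) / 2) * (1 / 2 : ℝ) ^ t
                  * (1 - 1 / (2 * η₀)) ^ t₀ * SRk.lam f x₀)) := by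
  -- In each strategy the burn-in has to beat a quantity bounded by the fifth power of the argument
  -- of the logarithm, so one constant serves both.
  refine ⟨5, by norm_num, ?_⟩
  intro d k L μ M η₀ f x₀ G₀ hk hkd hμ hM hη hf hL hconv hsc hinit hlow hup
  have h : SRk.Start k L μ M η₀ f x₀ G₀ :=
    ⟨⟨by omega, hμ, hM, hf, hL, hconv, hsc⟩, hk, hkd, hη, hinit, hlow, hup⟩
  refine ⟨?_, ?_⟩
  · intro Ω _ P _ U hU
    refine ⟨fun t => ⟨h.integrable_ratio hU t, h.integral_ratio_le hU t⟩, ?_⟩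
    intro δ hδ hδ1 t₀ ht₀
    exact h.randomized_lamAt_le hU hδ hδ1 (ht₀ ▸ Nat.le_ceil _)
  · intro U hU
    refine ⟨fun t => h.greedy_ratio_le hU t, ?_⟩
    intro t₀ ht₀ t
    exact h.greedy_lamAt_le hU (ht₀ ▸ Nat.le_ceil _) t
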